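/- Let $y_i$ ($i\in\mathbb{Z}$) be indeterminates. For $j\in\mathbb{Z}$ define rational functions $F_{j,k}$ ($k\ge -1$) recursively by $F_{j,-1}=F_{j,0}=1$ and $$F_{j,k+1}=\frac{F_{j-3,k}F_{j+3,k}+M_{j,k}F_{j-1,k}F_{j+1,k}}{F_{j,k-1}}\quad(k\ge 0),\qquad M_{j,k}=\prod_{i=-k}^{k}y_{3i+j}.$$ Let $n\ge 1$ be odd, and let $j,k$ be integers with $j+k$ odd and $k\in\{n,n+1\}$. Then $F_{j,k}$ is a polynomial with integer coefficients in the $y_i$, and there are integers $m_1,\dots,m_{2n}\ge 0$, depending only on $n,j,k$, such that the following holds. Let $(y_i)_{i\in\mathbb{Z}}$ be any family of elements of a field such that $y_{i+2n}=y_i$ for all $i$, $y_1y_2\cdots y_{2n}=1$, and $y_i=-1$ for all $i\in\{2,4,\dots,2n-2\}$ (no condition if $n=1$). Then the value of $F_{j,k}$ at $(y_i)$ is $$F_{j,k}=\begin{cases} y_1^{m_1}\cdots y_{2n}^{m_{2n}}\,(1+y_0)^{n}, & k=n,\\ y_1^{m_1}\cdots y_{2n}^{m_{2n}}\,(1+y_0)^{n+2},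 & k=n+1.\end{cases}$$ In particular, if $y_0\neq -1$ and $y_i\neq 0$ for all $i$, then $F_{j,k}\neq 0$ at $(y_i)$. -/

import Mathlib

namespace Pentagram

/-- The arithmetic progression `[a,b]_d = {a, a+d, a+2d, …, b}`; it is empty when `b < a`. -/
def arithProg (a b d : ℤ) : Set ℤ := {i | a ≤ i ∧ i ≤ b ∧ i ≡ a [ZMOD d]}

/-- Polynomials with integer coefficients in the variables `y_i`, `i ∈ ℤ`. -/
abbrev YPoly : Type := MvPolynomial ℤ ℤ

/-- The field of rational functions in the variables `y_i`, `i ∈ ℤ`. -/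
abbrev YRat : Type := FractionRing YPoly

noncomputable section

/-- The monomial `M_{j,k} = ∏_{i=-k}^{k} y_{3i+j}`. -/
def M (j : ℤ) (k : ℕ) : YPoly :=
  ∏ i ∈ Finset.Icc (-(k : ℤ)) (k : ℤ), MvPolynomial.X (3 * i + j)

/-- The `F`-polynomials with the second index shifted by one: `Fshift m j` is `F_{j,m-1}`.
Thus `F_{j,-1} = F_{j,0} = 1` and
`F_{j,k+1} = (F_{j-3,k} F_{j+3,k} + M_{j,k} F_{j-1,k} F_{j+1,k}) / F_{j,k-1}` for `k ≥ 0`,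
where the division is that of the field of rational functions. -/
def Fshift : ℕ → ℤ → YRat
  | 0, _ => 1
  | 1, _ => 1
  | k + 2, j =>
      (Fshift (k + 1) (j - 3) * Fshift (k + 1) (j + 3)
        + algebraMap YPoly YRat (M j k) * Fshift (k + 1) (j - 1) * Fshift (k + 1) (j + 1))
      / Fshift k j

/-- `F_{j,k}` for `k ≥ 0`, as an element of the field of rational functions. -/
def F (j : ℤ) (k : ℕ) : YRat := Fshift (k + 1) j

end

end Pentagram

namespace Pentagram

/-! The polynomial `F_{j,k}` is a partition function over alternating sign matrices of size `k`, and
the special values of `y` kill all but one or two of its terms.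

Both sides of the identity satisfy the same one-step reduction. On the one hand, `F_{j,k}(y)` equals
a product of factors `1 + y_i` times `F_{j,k-1}(y')`, where `y'` comes from `y` by the coefficient
dynamics `mutate` (`FVal_succ_eq_mutate`). On the other hand, `partitionSum` counts pairs of
compatible height functions on interlaced square arrays of sizes `k-1` and `k`. Exchanging the order
of summation replaces the pair of sizes `(m, m+1)` by `(m-1, m)`, and a local identity at each site
(`sum_zpow_newRange`) produces the same factors (`partitionSum_succ`). Thus the two agree at
positive rational points. Since the partition function is polynomial, `F_{j,k}` is that polynomial
`FPoly` (`algebraMap_FPoly`).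

A height measures how far a corner sum of a matrix lies below that of the identity matrix, so the
admissible height functions on the smaller array are the alternating sign matrices. Summing over the
larger array gives each matrix a monomial times the product of `1 + y` over its entries `1`
(`partitionSum_eq_sum`). When `j + k` is odd, all these `1 + y` have even index: they vanish except
at positions `(u, v)` with `2u + v ≡ c` modulo `n`, where `y = y_0`. As `n` is odd, these positions
meet every row and column once per period (`exists_grid`).

For `k = n` a single permutation matrix survives. For `k = n + 1` the first and last rows and
columns carry the same positions. If the corners are not among them, one matrix with `n + 2` ones
and a single `-1` survives. If they are, two permutation matrices with `n + 1` ones survive, and the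
ratio of their monomials is `y_0`, which supplies the missing factor `1 + y_0`. -/

open Finset

/-! ### Products along lines of indices -/

/-- The integers `-(k-1), -(k-3), …, k-1`. -/
def line (k : ℕ) : Finset ℤ := (range k).image fun i : ℕ => 2 * (i : ℤ) - ((k : ℤ) - 1)

lemma mem_line {k : ℕ} {x : ℤ} :
    x ∈ line k ↔ 1 - (k : ℤ) ≤ x ∧ x ≤ k - 1 ∧ (x + k - 1) % 2 = 0 := by
  simp only [line, mem_image, mem_range]
  constructor
  · rintro ⟨i, hi, rfl⟩; omega
  · rintro ⟨h1, h2, h3⟩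
    exact ⟨((x + k - 1) / 2).toNat, by omega, by omega⟩

lemma prod_line {R : Type*} [CommMonoid R] (f : ℤ → R) (k : ℕ) :
    ∏ x ∈ line k, f x = ∏ i ∈ range k, f (2 * (i : ℤ) - ((k : ℤ) - 1)) := by
  rw [line, prod_image]
  intro a _ b _ h
  simpa using h

/-- The product of `g i` over `i = j - 3 (k - 1), j - 3 (k - 3), …, j + 3 (k - 1)`. -/
def altProd {R : Type*} [CommMonoid R] (g : ℤ → R) (k : ℕ) (j : ℤ) : R :=
  ∏ x ∈ line k, g (j + 3 * x)

section CommMonoid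

variable {R : Type*} [CommMonoid R]

lemma altProd_eq (g : ℤ → R) (k : ℕ) (j : ℤ) :
    altProd g k j = ∏ i ∈ range k, g (j + 3 * (2 * (i : ℤ) - ((k : ℤ) - 1))) :=
  prod_line (fun x => g (j + 3 * x)) k

@[simp] lemma altProd_zero (g : ℤ → R) (j : ℤ) : altProd g 0 j = 1 := by
  simp [altProd_eq]

@[simp] lemma altProd_one (g : ℤ → R) (j : ℤ) : altProd g 1 j = g j := by
  simp [altProd_eq]

lemma altProd_mul (f g : ℤ → R) (k : ℕ) (j : ℤ) :
    altProd (fun i => f i * g i) k j = altProd f k j * altProd g k j := prod_mul_distrib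

lemma altProd_shift (g : ℤ → R) (k : ℕ) (j d : ℤ) :
    altProd (fun i => g (i + d)) k j = altProd g k (j + d) := by
  exact prod_congr rfl fun x _ => congrArg g (by ring)

/-- The condensation identity for products along a line. -/
lemma altProd_condensation (g : ℤ → R) (k : ℕ) (j : ℤ) :
    altProd g (k + 1) (j - 3) * altProd g (k + 1) (j + 3) =
      altProd g (k + 2) j * altProd g k j := by
  simp only [altProd_eq]
  set h : ℕ → R := fun i => g (j + 3 * (2 * (i : ℤ) - ((k : ℤ) + 1))) with hh
  have e1 : ∀ i : ℕ, g (j - 3 + 3 * (2 * (i : ℤ) - (((k + 1 : ℕ) : ℤ) - 1))) = h i := by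
    intro i; simp only [hh]; congr 1; push_cast; ring
  have e2 : ∀ i : ℕ, g (j + 3 + 3 * (2 * (i : ℤ) - (((k + 1 : ℕ) : ℤ) - 1))) = h (i + 1) := by
    intro i; simp only [hh]; congr 1; push_cast; ring
  have e3 : ∀ i : ℕ, g (j + 3 * (2 * (i : ℤ) - (((k + 2 : ℕ) : ℤ) - 1))) = h i := by
    intro i; simp only [hh]; congr 1; push_cast; ring
  have e4 : ∀ i : ℕ, g (j + 3 * (2 * (i : ℤ) - ((k : ℤ) - 1))) = h (i + 1) := by
    intro i; simp only [hh]; congr 1; push_cast; ring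
  simp only [e1, e2, e3, e4]
  rw [prod_range_succ h (k + 1), prod_range_succ (fun i => h (i + 1)) k, mul_assoc,
    mul_comm (h (k + 1))]

/-- The interval splits by parity: the `i` congruent to `k` modulo 2 form the line of size `k + 1`,
the others the line of size `k`. -/
lemma prod_Icc_eq_altProd (g : ℤ → R) (k : ℕ) (j : ℤ) :
    ∏ i ∈ Icc (-(k : ℤ)) k, g (3 * i + j) = altProd g (k + 1) j * altProd g k j := by
  unfold altProd
  rw [← prod_union]
  · refine prod_congr ?_ fun x _ => by rw [add_comm]
    ext x
    simp only [mem_union, mem_line, mem_Icc]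
    push_cast
    omega
  · rw [disjoint_left]
    intro x
    simp only [mem_line]
    push_cast
    omega

end CommMonoid

/-! ### The recursion in a field and the coefficient dynamics -/

section Field

variable {K : Type*} [Field K]

/-- The recursion defining the `F`-polynomials, with values in a field. -/
noncomputable def FVal (y : ℤ → K) : ℕ → ℤ → K
  | 0, _ => 1
  | 1, _ => 1
  | k + 2, j =>
      (FVal y (k + 1) (j - 3) * FVal y (k + 1) (j + 3)
        + (∏ i ∈ Icc (-(k : ℤ)) k, y (3 * i + j)) * FVal y (k + 1) (j - 1) * FVal y (k + 1) (j + 1))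
      / FVal y k j

/-- The coefficient dynamics: invert the variables in the parity class of `e`, and adjust the
others. -/
noncomputable def mutate (e : ℤ) (y : ℤ → K) (i : ℤ) : K :=
  if (i - e) % 2 = 0 then (y i)⁻¹
  else y i * ((y (i + -3) / (1 + y (i + -3))) * (y (i + 3) / (1 + y (i + 3))) *
    ((1 + y (i + -1)) * (1 + y (i + 1))))

lemma altProd_mutate_even (e : ℤ) (y : ℤ → K) (k : ℕ) (j : ℤ) (h : (j + k + 1 - e) % 2 = 0) :
    altProd (mutate e y) k j = (altProd y k j)⁻¹ := by
  unfold altProd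
  rw [← prod_inv_distrib]
  refine prod_congr rfl fun x hx => ?_
  rw [mem_line] at hx
  rw [mutate, if_pos (by omega)]

lemma altProd_mutate_odd (e : ℤ) (y : ℤ → K) (k : ℕ) (j : ℤ) (h : (j + k - e) % 2 = 0) :
    altProd (mutate e y) k j = altProd y k j *
      ((altProd y k (j - 3) / altProd (fun i => 1 + y i) k (j - 3)) *
       (altProd y k (j + 3) / altProd (fun i => 1 + y i) k (j + 3)) *
       (altProd (fun i => 1 + y i) k (j - 1) * altProd (fun i => 1 + y i) k (j + 1))) := by
  have : altProd (mutate e y) k j = altProd (fun i => y i * ((y (i + -3) / (1 + y (i + -3))) *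
      (y (i + 3) / (1 + y (i + 3))) * ((1 + y (i + -1)) * (1 + y (i + 1))))) k j := by
    refine prod_congr rfl fun x hx => ?_
    rw [mem_line] at hx
    rw [mutate, if_neg (by omega)]
  rw [this]
  have hd : ∀ l : ℤ, altProd y k l / altProd (fun i => 1 + y i) k l =
      altProd (fun i => y i / (1 + y i)) k l := fun l => (prod_div_distrib ..).symm
  simp only [hd, sub_eq_add_neg, altProd_mul]
  rw [← altProd_shift, ← altProd_shift, ← altProd_shift _ _ _ (-1), ← altProd_shift _ _ _ 1]

lemma altProd_ne_zero {g : ℤ → K} (hg : ∀ i, g i ≠ 0) (k : ℕ) (j : ℤ) : altProd g k j ≠ 0 :=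
  prod_ne_zero_iff.2 fun _ _ => hg _

/-- Changing the initial data by one time step. -/
theorem FVal_succ_eq_mutate {y : ℤ → K} (hy : ∀ i, y i ≠ 0) (hy1 : ∀ i, 1 + y i ≠ 0) (e : ℤ)
    (k : ℕ) : ∀ j : ℤ, (j + k + 1 - e) % 2 = 0 →
      FVal y (k + 1) j = altProd (fun i => 1 + y i) k j * FVal (mutate e y) k j := by
  induction k using Nat.strong_induction_on with
  | _ k ih =>
    match k, ih with
    | 0, _ => intro j _; simp [FVal]
    | 1, _ => intro j _; simp [FVal]
    | k + 2, ih =>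
      intro j hj
      push_cast at hj
      have h1 := ih (k + 1) (by omega)
      have h0 := ih k (by omega) j (by omega)
      rw [FVal, h1 (j - 3) (by push_cast; omega), h1 (j + 3) (by push_cast; omega),
        h1 (j - 1) (by push_cast; omega), h1 (j + 1) (by push_cast; omega), h0]
      rw [show FVal (mutate e y) (k + 2) j = _ from FVal.eq_3 _ _ _]
      rw [prod_Icc_eq_altProd, prod_Icc_eq_altProd, altProd_mutate_even e y k j (by omega),
        altProd_mutate_odd e y (k + 1) j (by push_cast; omega)]
      have n1 := fun k j => altProd_ne_zero hy k j
      have n2 := fun k j => altProd_ne_zero (g := fun i => 1 + y i) hy1 k j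
      have c1 := altProd_condensation y k j
      have c2 := altProd_condensation (fun i => 1 + y i) k j
      generalize FVal (mutate e y) k j = G
      -- The denominators now agree. Condensation removes the products of size `k + 2`, so that the
      -- numerators become comparable by clearing denominators.
      have u1 : altProd y (k + 2) j =
          altProd y (k + 1) (j - 3) * altProd y (k + 1) (j + 3) / altProd y k j :=
        eq_div_of_mul_eq (n1 k j) c1.symm
      have u2 : altProd (fun i => 1 + y i) (k + 2) j = altProd (fun i => 1 + y i) (k + 1) (j - 3) *
          altProd (fun i => 1 + y i) (k + 1) (j + 3) / altProd (fun i => 1 + y i) k j :=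
        eq_div_of_mul_eq (n2 k j) c2.symm
      rw [← mul_div_assoc, ← mul_div_mul_left _ G (n2 k j)]
      congr 1
      rw [u1, u2]
      have a1 := n1 k j
      have a2 := n2 k j
      have a3 := n2 (k + 1) (j - 3)
      have a4 := n2 (k + 1) (j + 3)
      field_simp

end Field

/-! ### Sites and height functions -/

/-- The square array of sites of size `k`. -/
def sites (k : ℕ) : Finset (ℤ × ℤ) := line k ×ˢ line k

lemma mem_sites {k : ℕ} {p : ℤ × ℤ} :
    p ∈ sites k ↔ (1 - (k : ℤ) ≤ p.1 ∧ p.1 ≤ k - 1 ∧ (p.1 + k - 1) % 2 = 0) ∧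
      (1 - (k : ℤ) ≤ p.2 ∧ p.2 ≤ k - 1 ∧ (p.2 + k - 1) % 2 = 0) := by
  rw [sites, mem_product, mem_line, mem_line]

@[simp] lemma sites_zero : sites 0 = ∅ := by simp [sites, line]

lemma parity_of_mem_sites {k : ℕ} {p : ℤ × ℤ} (hp : p ∈ sites k) : (p.1 + p.2) % 2 = 0 := by
  rw [mem_sites] at hp
  omega

lemma sites_sub_one_subset (m : ℕ) : sites (m - 1) ⊆ sites (m + 1) := by
  intro p hp
  rw [mem_sites] at hp ⊢
  push_cast
  omega

lemma mem_sites_sub_one {m : ℕ} {p : ℤ × ℤ} (hp : p ∈ sites (m + 1))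
    (he : (p.1 + 1, p.2 + 1) ∈ sites m) (hw : (p.1 + -1, p.2 + -1) ∈ sites m) :
    p ∈ sites (m - 1) := by
  rw [mem_sites] at *
  push_cast at hp
  simp only at he hw
  omega

/-- Height functions on the sites. -/
abbrev Height : Type := ℤ × ℤ →₀ ℤ

namespace Height

variable (b : Height) (p : ℤ × ℤ)

/-- The height at the neighbour `(+1,+1)`. -/
def e : ℤ := b (p.1 + 1, p.2 + 1)

/-- The height at the neighbour `(-1,-1)`. -/
def w : ℤ := b (p.1 + -1, p.2 + -1)

/-- The adjusted height at the neighbour `(+1,-1)`. -/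
def n : ℤ := b (p.1 + 1, p.2 + -1) - if p.2 ≤ p.1 then 0 else 1

/-- The adjusted height at the neighbour `(-1,+1)`. -/
def s : ℤ := b (p.1 + -1, p.2 + 1) - if p.1 ≤ p.2 then 0 else 1

/-- The heights at `p` that are compatible with the heights `b` at its neighbours. -/
noncomputable def newRange : Finset ℤ :=
  Icc (max (max (b.e p) (b.w p)) (max (b.n p) (b.s p)))
    (min (min (b.e p) (b.w p)) (min (b.n p) (b.s p)) + 1)

/-- The heights at `p` with which the heights `b` at its neighbours are compatible. -/
noncomputable def oldRange : Finset ℤ :=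
  Icc (max (max (b.e p - 1) (b.w p - 1)) (max (b.n p) (b.s p)))
    (min (min (b.e p) (b.w p)) (min (b.n p + 1) (b.s p + 1)))

variable {b p}

lemma mem_newRange {x : ℤ} : x ∈ b.newRange p ↔
    (b.e p ≤ x ∧ x ≤ b.e p + 1) ∧ (b.w p ≤ x ∧ x ≤ b.w p + 1) ∧
    (b.n p ≤ x ∧ x ≤ b.n p + 1) ∧ (b.s p ≤ x ∧ x ≤ b.s p + 1) := by
  rw [newRange, mem_Icc]; omega

lemma mem_oldRange {x : ℤ} : x ∈ b.oldRange p ↔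
    (b.e p - 1 ≤ x ∧ x ≤ b.e p) ∧ (b.w p - 1 ≤ x ∧ x ≤ b.w p) ∧
    (b.n p ≤ x ∧ x ≤ b.n p + 1) ∧ (b.s p ≤ x ∧ x ≤ b.s p + 1) := by
  rw [oldRange, mem_Icc]; omega

/-- Compatibility is a relation between adjacent sites, so it can be read from either end; an
`e`-neighbour seen from the other end is a `w`-neighbour, and likewise for `n` and `s`. The
corrections in `n` and `s` match because `p.1 - p.2` is even and changes by 2 across such an edge.
-/
lemma forall_mem_newRange_iff {a b : Height} :
    (∀ q : ℤ × ℤ, (q.1 + q.2) % 2 = 0 → b q ∈ a.newRange q) ↔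
      ∀ p : ℤ × ℤ, (p.1 + p.2) % 2 = 0 → a p ∈ b.oldRange p := by
  simp only [mem_newRange, mem_oldRange, e, w, n, s]
  constructor
  · rintro h ⟨x, z⟩ hp
    simp only at hp
    have h1 := (h (x + 1, z + 1) (by simp only; omega)).2.1
    have h2 := (h (x + -1, z + -1) (by simp only; omega)).1
    have h3 := (h (x + 1, z + -1) (by simp only; omega)).2.2.2
    have h4 := (h (x + -1, z + 1) (by simp only; omega)).2.2.1
    simp only [add_neg_cancel_right, neg_add_cancel_right] at h1 h2 h3 h4 ⊢
    clear h
    omega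
  · rintro h ⟨x, z⟩ hp
    simp only at hp
    have h1 := (h (x + 1, z + 1) (by simp only; omega)).2.1
    have h2 := (h (x + -1, z + -1) (by simp only; omega)).1
    have h3 := (h (x + 1, z + -1) (by simp only; omega)).2.2.2
    have h4 := (h (x + -1, z + 1) (by simp only; omega)).2.2.1
    simp only [add_neg_cancel_right, neg_add_cancel_right] at h1 h2 h3 h4 ⊢
    clear h
    omega

lemma eq_zero_of_notMem {k : ℕ} (h : b.support ⊆ sites k) (hp : p ∉ sites k) : b p = 0 := by
  by_contra h0
  exact hp (h (Finsupp.mem_support_iff.2 h0))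

lemma neighbors_eq_zero {k : ℕ} (h : b.support ⊆ sites (k - 1)) (hp : p ∉ sites k) :
    b.e p = 0 ∧ b.w p = 0 ∧ b (p.1 + 1, p.2 + -1) = 0 ∧ b (p.1 + -1, p.2 + 1) = 0 := by
  have key : ∀ q : ℤ × ℤ, (q.1 = p.1 + 1 ∨ q.1 = p.1 + -1) → (q.2 = p.2 + 1 ∨ q.2 = p.2 + -1) →
      b q = 0 := by
    intro q h1 h2
    refine eq_zero_of_notMem h fun hq => hp ?_
    rw [mem_sites] at hq ⊢
    omega
  exact ⟨key _ (by simp) (by simp), key _ (by simp) (by simp), key _ (by simp) (by simp),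
    key _ (by simp) (by simp)⟩

lemma mem_newRange_of_notMem {k : ℕ} (h : b.support ⊆ sites (k - 1)) (hp : p ∉ sites k) :
    (0 : ℤ) ∈ b.newRange p := by
  obtain ⟨h1, h2, h3, h4⟩ := neighbors_eq_zero h hp
  rw [mem_newRange, h1, h2, n, s, h3, h4]
  omega

lemma mem_oldRange_of_notMem {k : ℕ} (h : b.support ⊆ sites k) (hp : p ∉ sites (k + 1)) :
    (0 : ℤ) ∈ b.oldRange p := by
  obtain ⟨h1, h2, h3, h4⟩ := neighbors_eq_zero (k := k + 1) h hp
  rw [mem_oldRange, h1, h2, n, s, h3, h4]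
  omega

/-- Two diagonal steps give `b q ≤ b (q + (2, 2)) + 1`, and heights vanish beyond the array. Hence
bounded heights are automatic and any cutoff `N ≥ m` loses nothing. -/
lemma le_of_forall_mem_newRange {a b : Height} {m : ℕ} (hb : b.support ⊆ sites m)
    (h : ∀ q : ℤ × ℤ, (q.1 + q.2) % 2 = 0 → b q ∈ a.newRange q) (t : ℕ) :
    ∀ q : ℤ × ℤ, (q.1 + q.2) % 2 = 0 → (m : ℤ) - 2 * t ≤ q.1 → b q ≤ t := by
  induction t with
  | zero =>
    intro q _ hq
    rw [eq_zero_of_notMem hb (fun hm => ?_)]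
    · simp
    · rw [mem_sites] at hm
      push_cast at hq
      omega
  | succ t ih =>
    rintro ⟨x, z⟩ hxz hq
    push_cast at hq hxz ⊢
    have h1 := (mem_newRange.1 (h (x, z) hxz)).1.2
    have h2 := (mem_newRange.1 (h (x + 1 + 1, z + 1 + 1) (by simp only; omega))).2.1.1
    have h3 := ih (x + 1 + 1, z + 1 + 1) (by simp only; omega) (by simp only; omega)
    simp only [e, w, add_neg_cancel_right] at h1 h2
    omega

/-- Together with `mem_finsupp_newRange`, this identifies the two domains of summation when the sums
over `a` and `b` are exchanged. -/
lemma mem_finsupp_oldRange {a b : Height} {m N : ℕ} (hN : m ≤ N)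
    (ha : a ∈ (sites (m - 1)).finsupp (fun _ => Icc (0 : ℤ) N))
    (hb : b ∈ (sites m).finsupp a.newRange) :
    a ∈ (sites (m + 1)).finsupp b.oldRange ∧
      b ∈ (sites m).finsupp (fun _ => Icc (0 : ℤ) N) := by
  simp only [mem_finsupp_iff] at *
  have hnew : ∀ q : ℤ × ℤ, (q.1 + q.2) % 2 = 0 → b q ∈ a.newRange q := by
    intro q _
    by_cases hq : q ∈ sites m
    · exact hb.2 q hq
    · rw [eq_zero_of_notMem hb.1 hq]
      exact mem_newRange_of_notMem ha.1 hq
  refine ⟨⟨ha.1.trans (sites_sub_one_subset m), fun p hp =>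
      forall_mem_newRange_iff.1 hnew p (parity_of_mem_sites hp)⟩, hb.1, fun q hq => ?_⟩
  have h0 := parity_of_mem_sites hq
  have h1 := le_of_forall_mem_newRange hb.1 hnew m q h0 (by rw [mem_sites] at hq; omega)
  have h2 := (mem_newRange.1 (hnew q h0)).1.1
  have h3 : 0 ≤ a.e q := by
    rw [e]
    by_cases hp : (q.1 + 1, q.2 + 1) ∈ sites (m - 1)
    · exact (mem_Icc.1 (ha.2 _ hp)).1
    · rw [eq_zero_of_notMem ha.1 hp]
  rw [mem_Icc]
  omega

lemma mem_finsupp_newRange {a b : Height} {m N : ℕ}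
    (ha : a ∈ (sites (m + 1)).finsupp b.oldRange)
    (hb : b ∈ (sites m).finsupp (fun _ => Icc (0 : ℤ) N)) :
    a ∈ (sites (m - 1)).finsupp (fun _ => Icc (0 : ℤ) N) ∧
      b ∈ (sites m).finsupp a.newRange := by
  simp only [mem_finsupp_iff] at *
  have hold : ∀ p, a p ∈ b.oldRange p := by
    intro p
    by_cases hp : p ∈ sites (m + 1)
    · exact ha.2 p hp
    · rw [eq_zero_of_notMem ha.1 hp]
      exact mem_oldRange_of_notMem hb.1 hp
  have hb0 : ∀ q, 0 ≤ b q ∧ b q ≤ N := by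
    intro q
    by_cases hq : q ∈ sites m
    · exact mem_Icc.1 (hb.2 q hq)
    · rw [eq_zero_of_notMem hb.1 hq]
      omega
  -- At every site at least one of the two corrections in `n` and `s` is zero, so one of the lower
  -- bounds is a genuine, nonnegative height.
  have ha0 : ∀ p, 0 ≤ a p := by
    intro p
    have h1 := (mem_oldRange.1 (hold p)).2.2
    have h2 := hb0 (p.1 + 1, p.2 + -1)
    have h3 := hb0 (p.1 + -1, p.2 + 1)
    simp only [n, s] at h1
    omega
  refine ⟨⟨fun p hp => ?_, fun p _ => ?_⟩, hb.1, fun q hq =>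
    forall_mem_newRange_iff.2 (fun p _ => hold p) q (parity_of_mem_sites hq)⟩
  · by_contra hp'
    have hp1 := ha.1 hp
    rw [Finsupp.mem_support_iff] at hp
    have h1 := mem_oldRange.1 (hold p)
    have h0 := ha0 p
    -- A site of the larger array outside the smaller one has its `e`- or `w`-neighbour outside
    -- `sites m`. The height of `b` is zero there, which forces `a p ≤ 0`.
    have : b.e p = 0 ∨ b.w p = 0 := by
      by_contra! hcon
      exact hp' (mem_sites_sub_one hp1 (hb.1 (Finsupp.mem_support_iff.2 hcon.1))
        (hb.1 (Finsupp.mem_support_iff.2 hcon.2)))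
    omega
  · have h1 := (mem_oldRange.1 (hold p)).1.2
    have h2 := (hb0 (p.1 + 1, p.2 + 1)).2
    have h0 := ha0 p
    rw [e] at h1
    rw [mem_Icc]
    omega

/-- The condition that `b` is compatible with some heights at the sites of the other parity. -/
def Admissible (b : Height) : Prop := ∀ p : ℤ × ℤ, (p.1 + p.2) % 2 = 0 →
  (b.n p ≤ b.e p ∧ b.e p ≤ b.n p + 1) ∧ (b.n p ≤ b.w p ∧ b.w p ≤ b.n p + 1) ∧
  (b.s p ≤ b.e p ∧ b.e p ≤ b.s p + 1) ∧ (b.s p ≤ b.w p ∧ b.w p ≤ b.s p + 1)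

/-- Overlap of the intervals at `p` gives only one side of each inequality. The other side comes
from the site at distance 2 that shares the same two neighbours, where they play different roles. -/
lemma admissible_of_newRange {b : Height}
    (h : ∀ p : ℤ × ℤ, (p.1 + p.2) % 2 = 0 → (b.newRange p).Nonempty) : Admissible b := by
  rintro ⟨x, z⟩ hp
  simp only at hp
  obtain ⟨t0, h0⟩ := h (x, z) hp
  obtain ⟨t1, h1⟩ := h (x + 1 + 1, z) (by simp only; omega)
  obtain ⟨t2, h2⟩ := h (x + -1 + -1, z) (by simp only; omega)
  obtain ⟨t3, h3⟩ := h (x, z + 1 + 1) (by simp only; omega)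
  obtain ⟨t4, h4⟩ := h (x, z + -1 + -1) (by simp only; omega)
  clear h
  simp only [mem_newRange, e, w, n, s, add_neg_cancel_right, neg_add_cancel_right] at *
  omega

lemma admissible_of_oldRange {b : Height}
    (h : ∀ p : ℤ × ℤ, (p.1 + p.2) % 2 = 0 → (b.oldRange p).Nonempty) : Admissible b := by
  rintro ⟨x, z⟩ hp
  simp only at hp
  obtain ⟨t0, h0⟩ := h (x, z) hp
  obtain ⟨t1, h1⟩ := h (x + 1 + 1, z) (by simp only; omega)
  obtain ⟨t2, h2⟩ := h (x + -1 + -1, z) (by simp only; omega)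
  obtain ⟨t3, h3⟩ := h (x, z + 1 + 1) (by simp only; omega)
  obtain ⟨t4, h4⟩ := h (x, z + -1 + -1) (by simp only; omega)
  clear h
  simp only [mem_oldRange, e, w, n, s, add_neg_cancel_right, neg_add_cancel_right] at *
  omega

end Height

/-! ### The partition function and its invariance under the dynamics -/

lemma prod_sum_eq_sum_finsupp {ι α R : Type*} [Zero α] [CommSemiring R]
    (s : Finset ι) (t : ι → Finset α) (f : ι → α → R) :
    ∏ p ∈ s, ∑ x ∈ t p, f p x = ∑ h ∈ s.finsupp t, ∏ p ∈ s, f p (h p) := by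
  classical
  rw [prod_sum, Finset.finsupp, sum_map]
  refine sum_congr rfl fun g _ => ?_
  rw [← prod_attach s]
  refine prod_congr rfl fun p _ => ?_
  simp [Finsupp.indicator_of_mem p.2]

/-- The index of the variable at a site. -/
def idx (j : ℤ) (p : ℤ × ℤ) : ℤ := j + 2 * p.1 + p.2

section Field

variable {K : Type*} [Field K]

/-- The generating function of the height functions on an array of size `k`. -/
noncomputable def partitionSum (y : ℤ → K) (j : ℤ) (k N : ℕ) : K :=
  ∑ b ∈ (sites (k - 1)).finsupp (fun _ => Icc (0 : ℤ) N),
    (∏ q ∈ sites (k - 1), y (idx j q) ^ b q) *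
      ∏ p ∈ sites k, ∑ x ∈ Height.newRange b p, y (idx j p) ^ x

lemma prod_sites_shift {k : ℕ} {b : Height} (hb : b.support ⊆ sites k) (f : ℤ × ℤ → K)
    {d1 d2 : ℤ} (h1 : d1 = 1 ∨ d1 = -1) (h2 : d2 = 1 ∨ d2 = -1) :
    ∏ q ∈ sites k, f (q.1 + d1, q.2 + d2) ^ b q =
      ∏ p ∈ sites (k + 1), f p ^ b (p.1 + -d1, p.2 + -d2) := by
  rw [← prod_subset (s₁ := (sites k).image fun q => (q.1 + d1, q.2 + d2)) (s₂ := sites (k + 1))]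
  · rw [prod_image]
    · refine prod_congr rfl fun q _ => ?_
      simp
    · rintro ⟨x, z⟩ _ ⟨x', z'⟩ _ h
      simpa using h
  · intro p hp
    obtain ⟨q, hq, rfl⟩ := mem_image.1 hp
    rw [mem_sites] at hq ⊢
    push_cast
    omega
  · intro p _ hp
    rw [Height.eq_zero_of_notMem hb, zpow_zero]
    intro hq
    exact hp (mem_image.2 ⟨_, hq, by simp⟩)

/-- The local identity behind the invariance of the generating function. -/
lemma sum_zpow_newRange {y : K} (hy : y ≠ 0) (hy1 : 1 + y ≠ 0) {e w n s : ℤ}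
    (h1 : n ≤ e ∧ e ≤ n + 1) (h2 : n ≤ w ∧ w ≤ n + 1) (h3 : s ≤ e ∧ e ≤ s + 1)
    (h4 : s ≤ w ∧ w ≤ s + 1) :
    ∑ x ∈ Icc (max (max e w) (max n s)) (min (min e w) (min n s) + 1), y ^ x =
      (y / (1 + y)) ^ (e + w) * (1 + y) ^ (1 + n + s) *
        ∑ x ∈ Icc (max (max (e - 1) (w - 1)) (max n s)) (min (min e w) (min (n + 1) (s + 1))),
          (y⁻¹) ^ x := by
  -- These are the six configurations of the six-vertex model. The first is an entry `1` (two new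
  -- heights, one old), the second an entry `-1` (one new, two old), the rest are entries `0`.
  have key : (w = e ∧ n = e ∧ s = e) ∨ (e = n + 1 ∧ w = n + 1 ∧ s = n) ∨
      (w = n + 1 ∧ e = n ∧ s = n) ∨ (e = n + 1 ∧ w = n ∧ s = n) ∨
      (e = n ∧ w = n ∧ s = n + -1) ∨ (e = n + 1 ∧ w = n + 1 ∧ s = n + 1) := by omega
  have two : ∀ (u : K) (t : ℤ), ∑ x ∈ Icc t (t + 1), u ^ x = u ^ t + u ^ (t + 1) := by
    intro u t
    rw [show Icc t (t + 1) = {t, t + 1} by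
        ext x; simp only [mem_Icc, mem_insert, mem_singleton]; omega,
      sum_pair (by omega)]
  have one : ∀ (u : K) (t : ℤ), ∑ x ∈ Icc t t, u ^ x = u ^ t := by intro u t; simp
  rcases key with h | h | h | h | h | h
  · rw [show max (max e w) (max n s) = n by omega,
      show min (min e w) (min n s) + 1 = n + 1 by omega,
      show max (max (e - 1) (w - 1)) (max n s) = n by omega,
      show min (min e w) (min (n + 1) (s + 1)) = n by omega,
      two, one]
    obtain ⟨rfl, rfl, rfl⟩ := h
    simp [zpow_add₀ hy, zpow_add₀ hy1, zpow_add₀ (div_ne_zero hy hy1), div_zpow]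
    field_simp
  · rw [show max (max e w) (max n s) = n + 1 by omega,
      show min (min e w) (min n s) + 1 = n + 1 by omega,
      show max (max (e - 1) (w - 1)) (max n s) = n by omega,
      show min (min e w) (min (n + 1) (s + 1)) = n + 1 by omega,
      one, two]
    obtain ⟨rfl, rfl, rfl⟩ := h
    simp [zpow_add₀ hy, zpow_add₀ hy1, zpow_add₀ (div_ne_zero hy hy1), div_zpow]
    field_simp
    ring
  · rw [show max (max e w) (max n s) = n + 1 by omega,
      show min (min e w) (min n s) + 1 = n + 1 by omega,
      show max (max (e - 1) (w - 1)) (max n s) = n by omega,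
      show min (min e w) (min (n + 1) (s + 1)) = n by omega,
      one, one]
    obtain ⟨rfl, rfl, rfl⟩ := h
    simp [zpow_add₀ hy, zpow_add₀ hy1, zpow_add₀ (div_ne_zero hy hy1), div_zpow]
    field_simp
  · rw [show max (max e w) (max n s) = n + 1 by omega,
      show min (min e w) (min n s) + 1 = n + 1 by omega,
      show max (max (e - 1) (w - 1)) (max n s) = n by omega,
      show min (min e w) (min (n + 1) (s + 1)) = n by omega,
      one, one]
    obtain ⟨rfl, rfl, rfl⟩ := h
    simp [zpow_add₀ hy, zpow_add₀ hy1, zpow_add₀ (div_ne_zero hy hy1), div_zpow]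
    field_simp
  · rw [show max (max e w) (max n s) = n by omega,
      show min (min e w) (min n s) + 1 = n by omega,
      show max (max (e - 1) (w - 1)) (max n s) = n by omega,
      show min (min e w) (min (n + 1) (s + 1)) = n by omega,
      one, one]
    obtain ⟨rfl, rfl, rfl⟩ := h
    simp [zpow_add₀ hy, zpow_add₀ hy1, zpow_add₀ (div_ne_zero hy hy1), div_zpow]
    field_simp
  · rw [show max (max e w) (max n s) = n + 1 by omega,
      show min (min e w) (min n s) + 1 = n + 1 by omega,
      show max (max (e - 1) (w - 1)) (max n s) = n + 1 by omega,
      show min (min e w) (min (n + 1) (s + 1)) = n + 1 by omega,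
      one, one]
    obtain ⟨rfl, rfl, rfl⟩ := h
    simp [zpow_add₀ hy, zpow_add₀ hy1, zpow_add₀ (div_ne_zero hy hy1), div_zpow]
    field_simp

lemma altProd_eq_prod_sites (g : ℤ → K) (k : ℕ) (j : ℤ) :
    altProd g k j = ∏ p ∈ sites k, if p.1 = p.2 then g (idx j p) else 1 := by
  rw [sites, prod_product, altProd]
  refine prod_congr rfl fun x hx => ?_
  simp only [prod_ite_eq, if_pos hx, idx]
  congr 1
  ring

/-- The four diagonal neighbours of a site have indices shifted by `±3` and `±1`, exactly those in
`mutate`, so the extra factors can be regrouped by the site whose variable they contain. -/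
lemma prod_mutate_zpow {m : ℕ} {b : Height} (hb : b.support ⊆ sites m) (y : ℤ → K) {e j : ℤ}
    (he : (j + m - e) % 2 = 0) :
    ∏ q ∈ sites m, mutate e y (idx j q) ^ b q = (∏ q ∈ sites m, y (idx j q) ^ b q) *
      ∏ p ∈ sites (m + 1), (((y (idx j p) / (1 + y (idx j p))) ^ b.e p *
        (y (idx j p) / (1 + y (idx j p))) ^ b.w p) *
        ((1 + y (idx j p)) ^ b (p.1 + 1, p.2 + -1) *
          (1 + y (idx j p)) ^ b (p.1 + -1, p.2 + 1))) := by
  have h1 := prod_sites_shift hb (fun p => y (idx j p) / (1 + y (idx j p)))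
    (d1 := 1) (d2 := 1) (by simp) (by simp)
  have h2 := prod_sites_shift hb (fun p => y (idx j p) / (1 + y (idx j p)))
    (d1 := -1) (d2 := -1) (by simp) (by simp)
  have h3 := prod_sites_shift hb (fun p => 1 + y (idx j p))
    (d1 := 1) (d2 := -1) (by simp) (by simp)
  have h4 := prod_sites_shift hb (fun p => 1 + y (idx j p))
    (d1 := -1) (d2 := 1) (by simp) (by simp)
  simp only [neg_neg] at h1 h2 h3 h4
  simp only [prod_mul_distrib, Height.e, Height.w]
  rw [← h1, ← h2, ← h3, ← h4]
  simp only [← prod_mul_distrib]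
  refine prod_congr rfl fun q hq => ?_
  rw [mem_sites] at hq
  rw [mutate, if_neg (by simp only [idx]; omega)]
  rw [show idx j (q.1 + 1, q.2 + 1) = idx j q + 3 by simp only [idx]; ring,
    show idx j (q.1 + -1, q.2 + -1) = idx j q + -3 by simp only [idx]; ring,
    show idx j (q.1 + 1, q.2 + -1) = idx j q + 1 by simp only [idx]; ring,
    show idx j (q.1 + -1, q.2 + 1) = idx j q + -1 by simp only [idx]; ring]
  simp only [mul_zpow]

/-- For admissible `b` the local identity applies at each site. Otherwise some new range and some
old range are empty, and both sides are zero. -/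
lemma partitionSum_term {m : ℕ} {b : Height} (hb : b.support ⊆ sites m) {y : ℤ → K}
    (hy : ∀ i, y i ≠ 0) (hy1 : ∀ i, 1 + y i ≠ 0) {e j : ℤ} (he : (j + m - e) % 2 = 0) :
    (∏ q ∈ sites m, y (idx j q) ^ b q) *
        ∏ p ∈ sites (m + 1), ∑ x ∈ b.newRange p, y (idx j p) ^ x =
      altProd (fun i => 1 + y i) (m + 1) j * ((∏ q ∈ sites m, mutate e y (idx j q) ^ b q) *
        ∏ p ∈ sites (m + 1), ∑ x ∈ b.oldRange p, (y (idx j p))⁻¹ ^ x) := by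
  by_cases hadm : b.Admissible
  · rw [prod_mutate_zpow hb y he, altProd_eq_prod_sites, mul_assoc, mul_left_comm,
      ← prod_mul_distrib, ← prod_mul_distrib]
    congr 1
    refine prod_congr rfl fun p hp => ?_
    obtain ⟨h1, h2, h3, h4⟩ := hadm p (parity_of_mem_sites hp)
    rw [Height.newRange, sum_zpow_newRange (hy _) (hy1 _) h1 h2 h3 h4, ← mul_assoc,
      Height.oldRange]
    congr 1
    rw [← zpow_add₀ (div_ne_zero (hy _) (hy1 _)), ← zpow_add₀ (hy1 _), mul_left_comm]
    congr 1
    -- Off the diagonal exactly one of `n`, `s` is lowered by 1, cancelling the summand `1`; on the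
    -- diagonal neither is. Only diagonal sites therefore contribute to the prefactor.
    have hns : 1 + b.n p + b.s p =
        (if p.1 = p.2 then 1 else 0) + (b (p.1 + 1, p.2 + -1) + b (p.1 + -1, p.2 + 1)) := by
      simp only [Height.n, Height.s]
      omega
    rw [hns, zpow_add₀ (hy1 _)]
    congr 1
    split_ifs <;> simp
  · have hnew : ∃ p ∈ sites (m + 1), b.newRange p = ∅ := by
      by_contra! hcon
      refine hadm (Height.admissible_of_newRange fun p _ => ?_)
      by_cases hp : p ∈ sites (m + 1)
      · exact hcon p hp
      · exact ⟨0, Height.mem_newRange_of_notMem (k := m + 1) hb hp⟩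
    have hold : ∃ p ∈ sites (m + 1), b.oldRange p = ∅ := by
      by_contra! hcon
      refine hadm (Height.admissible_of_oldRange fun p _ => ?_)
      by_cases hp : p ∈ sites (m + 1)
      · exact hcon p hp
      · exact ⟨0, Height.mem_oldRange_of_notMem hb hp⟩
    obtain ⟨p, hp, hp0⟩ := hnew
    obtain ⟨q, hq, hq0⟩ := hold
    rw [prod_eq_zero hp (by rw [hp0, sum_empty]), prod_eq_zero hq (by rw [hq0, sum_empty])]
    simp

/-- The heights `b` on `sites m` are common to both sides: on the left they are the smaller array,
on the right the larger one. Summing out the other array first leaves a comparison for each fixed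
`b`. -/
theorem partitionSum_succ {y : ℤ → K} (hy : ∀ i, y i ≠ 0) (hy1 : ∀ i, 1 + y i ≠ 0) {m N : ℕ}
    (hN : m ≤ N) {e j : ℤ} (he : (j + m - e) % 2 = 0) :
    partitionSum y j (m + 1) N =
      altProd (fun i => 1 + y i) (m + 1) j * partitionSum (mutate e y) j m N := by
  have hexp : partitionSum (mutate e y) j m N =
      ∑ a ∈ (sites (m - 1)).finsupp (fun _ => Icc (0 : ℤ) N),
        ∑ b ∈ (sites m).finsupp (Height.newRange a),
          (∏ p ∈ sites (m + 1), (y (idx j p))⁻¹ ^ a p) *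
            ∏ q ∈ sites m, mutate e y (idx j q) ^ b q := by
    rw [partitionSum]
    refine sum_congr rfl fun a ha => ?_
    rw [prod_sum_eq_sum_finsupp, mul_sum]
    refine sum_congr rfl fun b _ => ?_
    congr 1
    -- Indices on `sites (m - 1)` have the parity of `e`, so `mutate` inverts them; the added sites
    -- carry height zero.
    rw [← prod_subset (sites_sub_one_subset m)]
    · refine prod_congr rfl fun p hp => ?_
      rw [mem_sites] at hp
      rw [mutate, if_pos (by simp only [idx]; omega)]
    · intro p _ hp
      rw [Height.eq_zero_of_notMem (mem_finsupp_iff.1 ha).1 hp, zpow_zero]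
  rw [hexp, sum_comm' (t' := (sites m).finsupp (fun _ => Icc (0 : ℤ) N))
    (s' := fun b => (sites (m + 1)).finsupp (Height.oldRange b))
    (fun a b => ⟨fun h => Height.mem_finsupp_oldRange hN h.1 h.2,
      fun h => Height.mem_finsupp_newRange h.1 h.2⟩), partitionSum, mul_sum]
  refine sum_congr rfl fun b hb => ?_
  rw [← sum_mul, ← prod_sum_eq_sum_finsupp (sites (m + 1)) (Height.oldRange b)
    (fun p x => (y (idx j p))⁻¹ ^ x), mul_comm _ (∏ q ∈ sites m, _)]
  exact partitionSum_term (mem_finsupp_iff.1 hb).1 hy hy1 he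

@[simp] lemma partitionSum_zero (y : ℤ → K) (j : ℤ) (N : ℕ) : partitionSum y j 0 N = 1 := by
  have : (∅ : Finset (ℤ × ℤ)).finsupp (fun _ => Icc (0 : ℤ) N) = {0} := by
    ext b
    simp [mem_finsupp_iff]
  simp [partitionSum, this]

end Field

/-! ### From positive rational points to polynomials -/

lemma mutate_pos {e : ℤ} {y : ℤ → ℚ} (hy : ∀ i, 0 < y i) (i : ℤ) : 0 < mutate e y i := by
  have h := fun i => hy i
  have h1 : ∀ i, 0 < 1 + y i := fun i => add_pos one_pos (hy i)
  rw [mutate]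
  split_ifs
  · exact inv_pos.2 (hy i)
  · have a1 := hy (i + -3)
    have a2 := hy (i + 3)
    have a3 := h1 (i + -3)
    have a4 := h1 (i + 3)
    have a5 := h1 (i + -1)
    have a6 := h1 (i + 1)
    have a7 := hy i
    positivity

/-- Positivity keeps every denominator nonzero under repeated mutation. The cutoff `N` stays fixed
while `k` decreases and `y` mutates. -/
theorem FVal_eq_partitionSum {N : ℕ} (k : ℕ) (hk : k ≤ N) : ∀ (y : ℤ → ℚ), (∀ i, 0 < y i) →
    ∀ j : ℤ, FVal y (k + 1) j = partitionSum y j k N := by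
  induction k with
  | zero => intro y _ j; simp [FVal]
  | succ k ih =>
    intro y hy j
    have h0 : ∀ i, y i ≠ 0 := fun i => (hy i).ne'
    have h1 : ∀ i, 1 + y i ≠ 0 := fun i => (add_pos one_pos (hy i)).ne'
    rw [partitionSum_succ h0 h1 (by omega) (e := j + k) (by simp),
      FVal_succ_eq_mutate h0 h1 (j + k) (k + 1) j (by push_cast; omega),
      ih (by omega) _ (mutate_pos hy)]

lemma FVal_pos {y : ℤ → ℚ} (hy : ∀ i, 0 < y i) (k : ℕ) : ∀ j, 0 < FVal y k j := by
  induction k using Nat.strong_induction_on with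
  | _ k ih =>
    match k, ih with
    | 0, _ => intro j; simp [FVal]
    | 1, _ => intro j; simp [FVal]
    | k + 2, ih =>
      intro j
      have h1 := ih (k + 1) (by omega)
      have h0 := ih k (by omega) j
      have hM : 0 < ∏ i ∈ Icc (-(k : ℤ)) k, y (3 * i + j) := prod_pos fun i _ => hy _
      rw [FVal]
      have a1 := h1 (j - 3)
      have a2 := h1 (j + 3)
      have a3 := h1 (j - 1)
      have a4 := h1 (j + 1)
      positivity

/-- The generating function of the height functions, as a polynomial. -/
noncomputable def FPoly (j : ℤ) (k : ℕ) : YPoly :=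
  ∑ b ∈ (sites (k - 1)).finsupp (fun _ => Icc (0 : ℤ) k),
    (∏ q ∈ sites (k - 1), MvPolynomial.X (idx j q) ^ (b q).toNat) *
      ∏ p ∈ sites k, ∑ x ∈ Height.newRange b p, MvPolynomial.X (idx j p) ^ x.toNat

lemma Height.nonneg_of_mem_finsupp {m N : ℕ} {b : Height}
    (hb : b ∈ (sites m).finsupp (fun _ => Icc (0 : ℤ) N)) (q : ℤ × ℤ) : 0 ≤ b q := by
  rw [mem_finsupp_iff] at hb
  by_cases hq : q ∈ sites m
  · exact (mem_Icc.1 (hb.2 q hq)).1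
  · rw [eq_zero_of_notMem hb.1 hq]

lemma aeval_FPoly {K : Type*} [Field K] (y : ℤ → K) (j : ℤ) (k : ℕ) :
    MvPolynomial.aeval y (FPoly j k) = partitionSum y j k k := by
  simp only [FPoly, partitionSum, map_sum, map_mul, map_prod, map_pow, MvPolynomial.aeval_X]
  refine sum_congr rfl fun b hb => ?_
  have h0 := Height.nonneg_of_mem_finsupp hb
  congr 1
  · refine prod_congr rfl fun q _ => ?_
    rw [← zpow_natCast, Int.toNat_of_nonneg (h0 q)]
  · refine prod_congr rfl fun p _ => sum_congr rfl fun x hx => ?_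
    have h1 := (Height.mem_newRange.1 hx).1.1
    have h2 : 0 ≤ Height.e b p := h0 _
    rw [← zpow_natCast, Int.toNat_of_nonneg (by omega)]

/-- Positive integer points already separate polynomials, since each coordinate runs over an
infinite set. -/
lemma ypoly_ext {P Q : YPoly} (h : ∀ y : ℤ → ℚ, (∀ i, 0 < y i) →
    MvPolynomial.aeval y P = MvPolynomial.aeval y Q) : P = Q := by
  refine MvPolynomial.funext_set (fun _ => Set.Ioi 0) (fun _ => Set.Ioi_infinite 0)
    fun x hx => ?_
  have hx' : ∀ i, 0 < x i := fun i => hx i (Set.mem_univ i)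
  have := h (algebraMap ℤ ℚ ∘ x) fun i => by simpa using hx' i
  rw [MvPolynomial.aeval_algebraMap_apply, MvPolynomial.aeval_algebraMap_apply] at this
  simpa [MvPolynomial.coe_aeval_eq_eval] using this

lemma aeval_FPoly_eq_FVal {y : ℤ → ℚ} (hy : ∀ i, 0 < y i) (j : ℤ) (k : ℕ) :
    MvPolynomial.aeval y (FPoly j k) = FVal y (k + 1) j := by
  rw [aeval_FPoly, FVal_eq_partitionSum k le_rfl y hy]

lemma FPoly_ne_zero (j : ℤ) (k : ℕ) : FPoly j k ≠ 0 := by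
  intro h
  have h1 := aeval_FPoly_eq_FVal (y := fun _ => 1) (fun _ => one_pos) j k
  rw [h, map_zero] at h1
  exact (FVal_pos (fun _ => one_pos) (k + 1) j).ne h1

lemma FPoly_zero (j : ℤ) : FPoly j 0 = 1 := by
  refine ypoly_ext fun y hy => ?_
  rw [aeval_FPoly_eq_FVal hy, map_one, FVal]

lemma FPoly_one (j : ℤ) : FPoly j 1 = 1 + M j 0 := by
  refine ypoly_ext fun y hy => ?_
  rw [aeval_FPoly_eq_FVal hy]
  simp [FVal, M]

lemma FPoly_condensation (j : ℤ) (k : ℕ) : FPoly j (k + 2) * FPoly j k =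
    FPoly (j - 3) (k + 1) * FPoly (j + 3) (k + 1) +
      M j (k + 1) * FPoly (j - 1) (k + 1) * FPoly (j + 1) (k + 1) := by
  refine ypoly_ext fun y hy => ?_
  simp only [map_mul, map_add, aeval_FPoly_eq_FVal hy, M, map_prod, MvPolynomial.aeval_X]
  rw [FVal.eq_3 y j (k + 1), div_mul_cancel₀ _ (FVal_pos hy _ _).ne']

theorem algebraMap_FPoly (k : ℕ) : ∀ j, algebraMap YPoly YRat (FPoly j k) = F j k := by
  unfold F
  induction k using Nat.strong_induction_on with
  | _ k ih =>
    match k, ih with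
    | 0, _ => intro j; simp [Fshift, FPoly_zero]
    | 1, _ => intro j; simp [Fshift, FPoly_one]
    | k + 2, ih =>
      intro j
      have h1 := ih (k + 1) (by omega)
      have h0 := ih k (by omega) j
      rw [Fshift, ← h1, ← h1, ← h1, ← h1, ← h0]
      have hne : algebraMap YPoly YRat (FPoly j k) ≠ 0 := by
        rw [Ne, FaithfulSMul.algebraMap_eq_zero_iff]
        exact FPoly_ne_zero j k
      rw [eq_div_iff hne, ← map_mul, FPoly_condensation]
      simp only [map_add, map_mul]

/-! ### Height functions and alternating sign matrices -/

/-- The conditions on an alternating sign matrix of size `k`: the partial sums of each row and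
column are `0` or `1`, and the total sums are `1`. -/
structure IsASM (k : ℕ) (α : ℕ → ℕ → ℤ) : Prop where
  row : ∀ u < k, ∀ v ≤ k, ∑ v' ∈ range v, α u v' = 0 ∨ ∑ v' ∈ range v, α u v' = 1
  row_total : ∀ u < k, ∑ v ∈ range k, α u v = 1
  col : ∀ v < k, ∀ u ≤ k, ∑ u' ∈ range u, α u' v = 0 ∨ ∑ u' ∈ range u, α u' v = 1
  col_total : ∀ v < k, ∑ u ∈ range k, α u v = 1

/-- The site with matrix coordinates `(u, v)` in the array of size `k`. -/
def cell (k u v : ℕ) : ℤ × ℤ := (2 * (u : ℤ) - ((k : ℤ) - 1), 2 * (v : ℤ) - ((k : ℤ) - 1))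

/-- The corner `(u, v)` between the sites of the array of size `k`. -/
def vertex (k u v : ℕ) : ℤ × ℤ := (2 * (u : ℤ) - k, 2 * (v : ℤ) - k)

lemma prod_sites {R : Type*} [CommMonoid R] (f : ℤ × ℤ → R) (k : ℕ) :
    ∏ p ∈ sites k, f p = ∏ u ∈ range k, ∏ v ∈ range k, f (cell k u v) := by
  rw [sites, prod_product, prod_line]
  refine prod_congr rfl fun u _ => ?_
  rw [prod_line]
  rfl

lemma exists_cell {k : ℕ} {p : ℤ × ℤ} (hp : p ∈ sites k) :
    ∃ u < k, ∃ v < k, p = cell k u v := by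
  rw [mem_sites] at hp
  refine ⟨((p.1 + k - 1) / 2).toNat, by omega, ((p.2 + k - 1) / 2).toNat, by omega, ?_⟩
  ext <;> simp only [cell] <;> omega

lemma cell_sub_one {k u v : ℕ} (hk : 0 < k) : cell (k - 1) u v = vertex k (u + 1) (v + 1) := by
  ext <;> simp only [cell, vertex] <;> omega

lemma vertex_mem_sites {k u v : ℕ} :
    vertex k u v ∈ sites (k - 1) ↔ (0 < u ∧ u < k) ∧ 0 < v ∧ v < k := by
  rw [mem_sites, vertex]
  omega

lemma cell_parity (k u v : ℕ) : ((cell k u v).1 + (cell k u v).2) % 2 = 0 := by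
  simp only [cell]
  omega

namespace Height

/-- The corner sum matrix of a height function. -/
def corner (b : Height) (k u v : ℕ) : ℤ := min (u : ℤ) v - b (vertex k u v)

/-- The alternating sign matrix of a height function. -/
def entry (b : Height) (k u v : ℕ) : ℤ :=
  1 + b.n (cell k u v) + b.s (cell k u v) - b.e (cell k u v) - b.w (cell k u v)

variable (b : Height) (k u v : ℕ)

lemma e_cell : b.e (cell k u v) = min (u : ℤ) v + 1 - b.corner k (u + 1) (v + 1) := by
  have : ((cell k u v).1 + 1, (cell k u v).2 + 1) = vertex k (u + 1) (v + 1) := by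
    ext <;> simp only [cell, vertex] <;> push_cast <;> ring
  rw [e, corner, this]
  omega

lemma w_cell : b.w (cell k u v) = min (u : ℤ) v - b.corner k u v := by
  have : ((cell k u v).1 + -1, (cell k u v).2 + -1) = vertex k u v := by
    ext <;> simp only [cell, vertex] <;> ring
  rw [w, corner, this]
  omega

/-- The correction in `n` is the jump of `min u v` when `u` grows by 1. Thus all four adjusted
heights at a cell share the offset `min u v`, and `entry` is a mixed second difference of corner
sums. -/
lemma n_cell : b.n (cell k u v) = min (u : ℤ) v - b.corner k (u + 1) v := by
  have : ((cell k u v).1 + 1, (cell k u v).2 + -1) = vertex k (u + 1) v := by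
    ext <;> simp only [cell, vertex] <;> push_cast <;> ring
  rw [n, corner, this]
  simp only [cell]
  omega

lemma s_cell : b.s (cell k u v) = min (u : ℤ) v - b.corner k u (v + 1) := by
  have : ((cell k u v).1 + -1, (cell k u v).2 + 1) = vertex k u (v + 1) := by
    ext <;> simp only [cell, vertex] <;> push_cast <;> ring
  rw [s, corner, this]
  simp only [cell]
  omega

lemma entry_eq : b.entry k u v = b.corner k (u + 1) (v + 1) + b.corner k u v -
    b.corner k (u + 1) v - b.corner k u (v + 1) := by
  rw [entry, e_cell, w_cell, n_cell, s_cell]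
  ring

variable {b k}

lemma corner_boundary (hb : b.support ⊆ sites (k - 1)) {u v : ℕ}
    (h : u = 0 ∨ v = 0 ∨ u = k ∨ v = k) : b.corner k u v = min (u : ℤ) v := by
  rw [corner, eq_zero_of_notMem hb, sub_zero]
  rw [vertex_mem_sites]
  omega

lemma sum_entry_row (hb : b.support ⊆ sites (k - 1)) {u : ℕ} (hu : u < k) (v : ℕ) :
    ∑ v' ∈ range v, b.entry k u v' = b.corner k (u + 1) v - b.corner k u v := by
  induction v with
  | zero =>
    rw [corner_boundary hb (by omega),
      corner_boundary hb (by omega), sum_range_zero]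
    omega
  | succ v ih =>
    rw [sum_range_succ, ih, entry_eq]
    ring

lemma sum_entry_col (hb : b.support ⊆ sites (k - 1)) {v : ℕ} (hv : v < k) (u : ℕ) :
    ∑ u' ∈ range u, b.entry k u' v = b.corner k u (v + 1) - b.corner k u v := by
  induction u with
  | zero =>
    rw [corner_boundary hb (by omega),
      corner_boundary hb (by omega), sum_range_zero]
    omega
  | succ u ih =>
    rw [sum_range_succ, ih, entry_eq]
    ring

lemma corner_eq_sum (hb : b.support ⊆ sites (k - 1)) {u v : ℕ} (hu : u ≤ k) (hv : v ≤ k) :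
    b.corner k u v = ∑ u' ∈ range u, ∑ v' ∈ range v, b.entry k u' v' := by
  induction u with
  | zero =>
    rw [corner_boundary hb (by omega), sum_range_zero]
    omega
  | succ u ih =>
    rw [sum_range_succ, ← ih (by omega), sum_entry_row hb (by omega)]
    ring

/-- Partial row and column sums are first differences of corner sums, and admissibility says that
these are `0` or `1`; the totals come from the boundary values `min u v`. -/
lemma isASM_entry (hb : b.support ⊆ sites (k - 1)) (hadm : b.Admissible) :
    IsASM k (b.entry k) where
  row u hu v hv := by
    rw [sum_entry_row hb hu]
    have := hadm _ (cell_parity k u v)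
    rw [e_cell, w_cell, n_cell, s_cell] at this
    omega
  row_total u hu := by
    rw [sum_entry_row hb hu, corner_boundary hb (by omega),
      corner_boundary hb (by omega)]
    omega
  col v hv u hu := by
    rw [sum_entry_col hb hv]
    have := hadm _ (cell_parity k u v)
    rw [e_cell, w_cell, n_cell, s_cell] at this
    omega
  col_total v hv := by
    rw [sum_entry_col hb hv, corner_boundary hb (by omega),
      corner_boundary hb (by omega)]
    omega

lemma eq_of_entry_eq {b' : Height} (hb : b.support ⊆ sites (k - 1))
    (hb' : b'.support ⊆ sites (k - 1)) (h : ∀ u < k, ∀ v < k, b.entry k u v = b'.entry k u v) :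
    b = b' := by
  ext q
  by_cases hq : q ∈ sites (k - 1)
  · have hk : 0 < k := by rw [mem_sites] at hq; omega
    obtain ⟨u, hu, v, hv, rfl⟩ := exists_cell hq
    have hc : b.corner k (u + 1) (v + 1) = b'.corner k (u + 1) (v + 1) := by
      rw [corner_eq_sum hb (by omega) (by omega), corner_eq_sum hb' (by omega) (by omega)]
      refine sum_congr rfl fun u' hu' => sum_congr rfl fun v' hv' => ?_
      rw [mem_range] at hu' hv'
      exact h u' (by omega) v' (by omega)
    rw [corner, corner] at hc
    rw [cell_sub_one hk]
    omega
  · rw [eq_zero_of_notMem hb hq, eq_zero_of_notMem hb' hq]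

/-- The height function of an alternating sign matrix. -/
noncomputable def ofMatrix (k : ℕ) (α : ℕ → ℕ → ℤ) : Height :=
  Finsupp.indicator (sites (k - 1)) fun p _ =>
    min ((p.1 + k) / 2) ((p.2 + k) / 2) -
      ∑ u ∈ range ((p.1 + k) / 2).toNat, ∑ v ∈ range ((p.2 + k) / 2).toNat, α u v

lemma support_ofMatrix (k : ℕ) (α : ℕ → ℕ → ℤ) : (ofMatrix k α).support ⊆ sites (k - 1) :=
  Finsupp.support_indicator_subset _ _

lemma corner_ofMatrix {α : ℕ → ℕ → ℤ} (hα : IsASM k α) {u v : ℕ} (hu : u ≤ k) (hv : v ≤ k) :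
    (ofMatrix k α).corner k u v = ∑ u' ∈ range u, ∑ v' ∈ range v, α u' v' := by
  by_cases h : vertex k u v ∈ sites (k - 1)
  · rw [corner, ofMatrix, Finsupp.indicator_of_mem h]
    simp [vertex]
  · rw [vertex_mem_sites] at h
    rw [corner_boundary (support_ofMatrix k α) (by omega)]
    have : u = 0 ∨ v = 0 ∨ u = k ∨ v = k := by omega
    rcases this with rfl | rfl | rfl | rfl
    · simp
    · simp
    · rw [sum_comm, sum_congr rfl fun v' hv' => hα.col_total v' (by rw [mem_range] at hv'; omega)]
      simp [hv]
    · rw [sum_congr rfl fun u' hu' => hα.row_total u' (by rw [mem_range] at hu'; omega)]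
      simp [hu]

lemma entry_ofMatrix {α : ℕ → ℕ → ℤ} (hα : IsASM k α) {u v : ℕ} (hu : u < k) (hv : v < k) :
    (ofMatrix k α).entry k u v = α u v := by
  rw [entry_eq, corner_ofMatrix hα (by omega) (by omega), corner_ofMatrix hα (by omega) (by omega),
    corner_ofMatrix hα (by omega) (by omega), corner_ofMatrix hα (by omega) (by omega)]
  simp only [sum_range_succ, sum_add_distrib]
  ring

lemma corner_ofMatrix_succ_left {α : ℕ → ℕ → ℤ} (hα : IsASM k α) {u v : ℕ} (hu : u < k)
    (hv : v ≤ k) : (ofMatrix k α).corner k u v ≤ (ofMatrix k α).corner k (u + 1) v ∧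
      (ofMatrix k α).corner k (u + 1) v ≤ (ofMatrix k α).corner k u v + 1 := by
  rw [corner_ofMatrix hα (by omega) (by omega), corner_ofMatrix hα (by omega) (by omega),
    sum_range_succ]
  have := hα.row u hu v hv
  omega

lemma corner_ofMatrix_succ_right {α : ℕ → ℕ → ℤ} (hα : IsASM k α) {u v : ℕ} (hu : u ≤ k)
    (hv : v < k) : (ofMatrix k α).corner k u v ≤ (ofMatrix k α).corner k u (v + 1) ∧
      (ofMatrix k α).corner k u (v + 1) ≤ (ofMatrix k α).corner k u v + 1 := by
  rw [corner_ofMatrix hα (by omega) (by omega), corner_ofMatrix hα (by omega) (by omega),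
    sum_comm, sum_comm (s := range u), sum_range_succ]
  have := hα.col v hv u hu
  omega

lemma admissible_ofMatrix {α : ℕ → ℕ → ℤ} (hα : IsASM k α) : (ofMatrix k α).Admissible := by
  intro p hp
  by_cases hps : p ∈ sites k
  · obtain ⟨u, hu, v, hv, rfl⟩ := exists_cell hps
    rw [e_cell, w_cell, n_cell, s_cell]
    have h1 := corner_ofMatrix_succ_left hα (u := u) (v := v) (by omega) (by omega)
    have h2 := corner_ofMatrix_succ_left hα (u := u) (v := v + 1) (by omega) (by omega)
    have h3 := corner_ofMatrix_succ_right hα (u := u) (v := v) (by omega) (by omega)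
    have h4 := corner_ofMatrix_succ_right hα (u := u + 1) (v := v) (by omega) (by omega)
    omega
  · obtain ⟨h1, h2, h3, h4⟩ := neighbors_eq_zero (support_ofMatrix k α) hps
    rw [h1, h2, n, s, h3, h4]
    omega

lemma corner_ofMatrix_mem {α : ℕ → ℕ → ℤ} (hα : IsASM k α) {u v : ℕ} (hu : u ≤ k) (hv : v ≤ k) :
    0 ≤ (ofMatrix k α).corner k u v ∧ (ofMatrix k α).corner k u v ≤ min u v := by
  have hA : ∀ u' ≤ k, 0 ≤ (ofMatrix k α).corner k u' v ∧ (ofMatrix k α).corner k u' v ≤ u' := by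
    intro u' hu'
    induction u' with
    | zero => rw [corner_ofMatrix hα hu' hv]; simp
    | succ t ih =>
      have := corner_ofMatrix_succ_left hα (u := t) hu' hv
      have := ih (by omega)
      push_cast
      omega
  have hB : ∀ v' ≤ k, (ofMatrix k α).corner k u v' ≤ v' := by
    intro v' hv'
    induction v' with
    | zero => rw [corner_ofMatrix hα hu hv']; simp
    | succ t ih =>
      have := corner_ofMatrix_succ_right hα (v := t) hu hv'
      have := ih (by omega)
      push_cast
      omega
  have := hA u hu
  have := hB v hv
  omega

lemma ofMatrix_mem {α : ℕ → ℕ → ℤ} (hα : IsASM k α) :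
    ofMatrix k α ∈ (sites (k - 1)).finsupp (fun _ => Icc (0 : ℤ) k) := by
  rw [mem_finsupp_iff]
  refine ⟨support_ofMatrix k α, fun q hq => ?_⟩
  have hk : 0 < k := by rw [mem_sites] at hq; omega
  obtain ⟨u, hu, v, hv, rfl⟩ := exists_cell hq
  have := corner_ofMatrix_mem hα (u := u + 1) (v := v + 1) (by omega) (by omega)
  rw [corner, ← cell_sub_one hk] at this
  rw [mem_Icc]
  omega

end Height

/-! ### The partition function as a sum over alternating sign matrices -/

section Field

variable {K : Type*} [Field K]

/-- The monomial of a height function, with the heights at the other sites as low as possible. -/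
noncomputable def weight (y : ℤ → K) (j : ℤ) (k : ℕ) (b : Height) : K :=
  (∏ q ∈ sites (k - 1), y (idx j q) ^ b q) *
    ∏ p ∈ sites k, y (idx j p) ^ max (Height.e b p) (Height.w b p)

/-- The product of `1 + y` over the entries `1` of a matrix. -/
noncomputable def onesProd (y : ℤ → K) (j : ℤ) (k : ℕ) (α : ℕ → ℕ → ℤ) : K :=
  ∏ u ∈ range k, ∏ v ∈ range k, if α u v = 1 then 1 + y (idx j (cell k u v)) else 1

/-- Admissibility places `n` and `s` below `e` and `w`, so the range starts at `max e w` and ends at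
`min n s + 1`. It has two elements exactly when all four heights coincide, that is, at an entry `1`,
and one element otherwise. -/
lemma sum_newRange {y : K} (hy : y ≠ 0) {b : Height} {p : ℤ × ℤ} (hb : b.Admissible)
    (hp : (p.1 + p.2) % 2 = 0) : ∑ x ∈ b.newRange p, y ^ x = y ^ max (b.e p) (b.w p) *
      if 1 + b.n p + b.s p - b.e p - b.w p = 1 then 1 + y else 1 := by
  have h := hb p hp
  rw [Height.newRange]
  set l := max (b.e p) (b.w p) with hl
  split_ifs with h1
  · have : Icc (max l (max (b.n p) (b.s p))) (min (min (b.e p) (b.w p)) (min (b.n p) (b.s p)) + 1) =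
        {l, l + 1} := by
      ext x
      simp only [mem_Icc, mem_insert, mem_singleton]
      omega
    rw [this, sum_pair (by omega), zpow_add₀ hy, zpow_one]
    ring
  · have : Icc (max l (max (b.n p) (b.s p))) (min (min (b.e p) (b.w p)) (min (b.n p) (b.s p)) + 1) =
        {l} := by
      ext x
      simp only [mem_Icc, mem_singleton]
      omega
    rw [this, sum_singleton, mul_one]

lemma prod_sum_newRange {y : ℤ → K} (hy : ∀ i, y i ≠ 0) (j : ℤ) (k : ℕ) {b : Height}
    (hb : b.Admissible) : ∏ p ∈ sites k, ∑ x ∈ b.newRange p, y (idx j p) ^ x =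
      (∏ p ∈ sites k, y (idx j p) ^ max (b.e p) (b.w p)) * onesProd y j k (b.entry k) := by
  rw [onesProd, prod_congr rfl fun p hp => sum_newRange (hy _) hb (parity_of_mem_sites hp),
    prod_mul_distrib, prod_sites (fun p => ite _ _ _)]
  rfl

lemma onesProd_congr (y : ℤ → K) (j : ℤ) {k : ℕ} {α β : ℕ → ℕ → ℤ}
    (h : ∀ u < k, ∀ v < k, α u v = β u v) : onesProd y j k α = onesProd y j k β := by
  refine prod_congr rfl fun u hu => prod_congr rfl fun v hv => ?_
  rw [h u (mem_range.1 hu) v (mem_range.1 hv)]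

/-- A matrix with an entry `1` at a site where `y = -1` contributes zero, so `A` need only contain
the remaining ones. Matrices are functions on all of `ℕ`, hence `hinj` asks that members of `A` be
distinguished inside the square. -/
lemma partitionSum_eq_sum {y : ℤ → K} (hy : ∀ i, y i ≠ 0) (j : ℤ) (k : ℕ)
    (A : Finset (ℕ → ℕ → ℤ)) (hA : ∀ α ∈ A, IsASM k α)
    (hinj : ∀ α ∈ A, ∀ β ∈ A, (∀ u < k, ∀ v < k, α u v = β u v) → α = β)
    (hall : ∀ β, IsASM k β → (∀ u < k, ∀ v < k, β u v = 1 → 1 + y (idx j (cell k u v)) ≠ 0) →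
      ∃ α ∈ A, ∀ u < k, ∀ v < k, β u v = α u v) :
    partitionSum y j k k =
      ∑ α ∈ A, weight y j k (Height.ofMatrix k α) * onesProd y j k α := by
  classical
  have hterm : ∀ b : Height, b.Admissible → (∏ q ∈ sites (k - 1), y (idx j q) ^ b q) *
      ∏ p ∈ sites k, ∑ x ∈ b.newRange p, y (idx j p) ^ x =
      weight y j k b * onesProd y j k (b.entry k) := by
    intro b hb
    rw [prod_sum_newRange hy j k hb, weight, mul_assoc]
  rw [partitionSum, ← sum_subset (s₁ := A.image (Height.ofMatrix k))]
  · rw [sum_image]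
    · refine sum_congr rfl fun α hα => ?_
      rw [hterm _ (Height.admissible_ofMatrix (hA α hα)),
        onesProd_congr y j fun u hu v hv => Height.entry_ofMatrix (hA α hα) hu hv]
    · intro α hα β hβ h
      refine hinj α hα β hβ fun u hu v hv => ?_
      rw [← Height.entry_ofMatrix (hA α hα) hu hv, h, Height.entry_ofMatrix (hA β hβ) hu hv]
  · intro b hb
    obtain ⟨α, hα, rfl⟩ := mem_image.1 hb
    exact Height.ofMatrix_mem (hA α hα)
  · intro b hb hbA
    by_contra hne
    apply hbA
    have hsupp := (mem_finsupp_iff.1 hb).1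
    have hadm : b.Admissible := by
      refine Height.admissible_of_newRange fun p _ => ?_
      by_cases hp : p ∈ sites k
      · refine nonempty_iff_ne_empty.2 fun h0 => hne ?_
        rw [prod_eq_zero hp (by rw [h0, sum_empty]), mul_zero]
      · exact ⟨0, Height.mem_newRange_of_notMem hsupp hp⟩
    obtain ⟨α, hα, h⟩ := hall _ (Height.isASM_entry hsupp hadm) fun u hu v hv h1 h0 => by
      apply hne
      rw [hterm b hadm, onesProd, prod_eq_zero (mem_range.2 hu), mul_zero]
      rw [prod_eq_zero (mem_range.2 hv)]
      rw [if_pos h1, h0]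
    refine mem_image.2 ⟨α, hα, Height.eq_of_entry_eq (Height.support_ofMatrix k α) hsupp ?_⟩
    intro u hu v hv
    rw [Height.entry_ofMatrix (hA α hα) hu hv, h u hu v hv]

end Field

/-! ### Monomials reduced to one period -/

/-- The monomial of an alternating sign matrix in terms of the variables of one period. -/
lemma exists_exponents {ι : Type*} (s : Finset ι) (f : ι → ℤ) (ε : ι → ℕ) {N : ℤ} (hN : 0 < N) :
    ∃ m : ℤ → ℕ, ∀ (K : Type*) [Field K] (y : ℤ → K), Function.Periodic y N →
      ∏ t ∈ s, y (f t) ^ ε t = ∏ i ∈ Icc 1 N, y i ^ m i := by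
  classical
  -- Exponents are collected by residue class, with representatives `1, …, N`; the choice involves
  -- neither the field nor `y`.
  refine ⟨fun i => ∑ t ∈ s with (f t - 1) % N + 1 = i, ε t, fun K _ y hy => ?_⟩
  have hmod : ∀ i, y i = y ((i - 1) % N + 1) := by
    intro i
    have h := hy.int_mul ((i - 1) / N) ((i - 1) % N + 1)
    rw [← h]
    congr 1
    have := Int.emod_add_mul_ediv (i - 1) N
    push_cast
    linarith [mul_comm N ((i - 1) / N)]
  rw [← prod_fiberwise_of_maps_to (t := Icc 1 N) (g := fun t => (f t - 1) % N + 1)]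
  · refine prod_congr rfl fun i _ => ?_
    rw [← prod_pow_eq_pow_sum]
    refine prod_congr rfl fun t ht => ?_
    rw [hmod, (mem_filter.1 ht).2]
  · intro t _
    have := Int.emod_nonneg (f t - 1) hN.ne'
    have := Int.emod_lt_of_pos (f t - 1) hN
    rw [mem_Icc]
    omega

lemma exists_exponents_weight (j : ℤ) {k : ℕ} {α : ℕ → ℕ → ℤ} (hα : IsASM k α) {N : ℤ}
    (hN : 0 < N) : ∃ m : ℤ → ℕ, ∀ (K : Type*) [Field K] (y : ℤ → K), Function.Periodic y N →
      weight y j k (Height.ofMatrix k α) = ∏ i ∈ Icc 1 N, y i ^ m i := by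
  set b := Height.ofMatrix k α
  have h0 := Height.nonneg_of_mem_finsupp (Height.ofMatrix_mem hα)
  obtain ⟨m1, h1⟩ := exists_exponents (sites (k - 1)) (idx j) (fun q => (b q).toNat) hN
  obtain ⟨m2, h2⟩ := exists_exponents (sites k) (idx j) (fun p => (max (b.e p) (b.w p)).toNat) hN
  refine ⟨fun i => m1 i + m2 i, fun K _ y hy => ?_⟩
  simp only [pow_add, prod_mul_distrib]
  rw [← h1 K y hy, ← h2 K y hy, weight]
  congr 1
  · refine prod_congr rfl fun q _ => ?_
    rw [← zpow_natCast, Int.toNat_of_nonneg (h0 q)]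
  · refine prod_congr rfl fun p _ => ?_
    have he : 0 ≤ b.e p := h0 _
    rw [← zpow_natCast, Int.toNat_of_nonneg (by omega)]

/-! ### Periodic grids and the matrices whose ones lie on them -/

/-- The set of positions `G` is periodic with period `n` in both directions and meets each row and
column exactly once in a period, in the positions given by `g` and `h`. -/
structure Grid (n : ℕ) (G : ℕ → ℕ → Prop) (g h : ℕ → ℕ) : Prop where
  g_lt : ∀ u, g u < n
  h_lt : ∀ v, h v < n
  row : ∀ u v, v < n → (G u v ↔ v = g u)
  col : ∀ u v, u < n → (G u v ↔ u = h v)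
  right : ∀ u, G u n ↔ G u 0
  bottom : ∀ v, G n v ↔ G 0 v

/-- The permutation matrix of `g`. -/
def permMatrix (g : ℕ → ℕ) (u v : ℕ) : ℤ := if v = g u then 1 else 0

lemma sum_range_ite_eq (m a : ℕ) :
    ∑ v ∈ range m, (if v = a then (1 : ℤ) else 0) = if a < m then 1 else 0 := by
  simp [sum_ite_eq']

lemma isASM_permMatrix {k : ℕ} {g h : ℕ → ℕ} (hg : ∀ u < k, g u < k) (hh : ∀ v < k, h v < k)
    (hgh : ∀ u < k, ∀ v < k, (v = g u ↔ u = h v)) : IsASM k (permMatrix g) where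
  row u hu v hv := by
    simp only [permMatrix, sum_range_ite_eq]
    omega
  row_total u hu := by
    simp only [permMatrix, sum_range_ite_eq, if_pos (hg u hu)]
  col v hv u hu := by
    rw [sum_congr rfl fun u' hu' => show permMatrix g u' v = if u' = h v then 1 else 0 by
      simp only [permMatrix, hgh u' (by rw [mem_range] at hu'; omega) v hv], sum_range_ite_eq]
    omega
  col_total v hv := by
    rw [sum_congr rfl fun u' hu' => show permMatrix g u' v = if u' = h v then 1 else 0 by
      simp only [permMatrix, hgh u' (by rw [mem_range] at hu'; omega) v hv], sum_range_ite_eq,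
      if_pos (hh v hv)]

/-- A partial sum confined to `{0, 1}` can leave `0` only through an entry `1`. -/
lemma partial_sum_stays_zero {k : ℕ} {f : ℕ → ℤ}
    (hf : ∀ v ≤ k, ∑ v' ∈ range v, f v' = 0 ∨ ∑ v' ∈ range v, f v' = 1) {a b : ℕ} (hab : a ≤ b)
    (hb : b ≤ k) (ha : ∑ v' ∈ range a, f v' = 0) (hone : ∀ v, a ≤ v → v < b → f v ≠ 1) :
    ∑ v' ∈ range b, f v' = 0 := by
  induction b, hab using Nat.le_induction with
  | base => exact ha
  | succ b hab ih =>
    have h1 := ih (by omega) fun v hv hv' => hone v hv (by omega)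
    have h2 := hf (b + 1) hb
    have h3 := hone b hab (by omega)
    rw [sum_range_succ, h1] at h2 ⊢
    omega

/-- A row of an alternating sign matrix with only one possible position for an entry `1`. -/
lemma eq_ite_of_one {k g : ℕ} {f : ℕ → ℤ}
    (hf : ∀ v ≤ k, ∑ v' ∈ range v, f v' = 0 ∨ ∑ v' ∈ range v, f v' = 1)
    (htot : ∑ v ∈ range k, f v = 1) (hone : ∀ v < k, f v = 1 → v = g) :
    ∀ v < k, f v = if v = g then 1 else 0 := by
  have key : ∀ v ≤ k, ∑ v' ∈ range v, f v' = if g < v then 1 else 0 := by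
    intro v hv
    split_ifs with hgv
    · refine (hf v hv).resolve_left fun h0 => ?_
      have := partial_sum_stays_zero hf hv le_rfl h0 fun v' h1 h2 h3 => by
        have := hone v' h2 h3
        omega
      omega
    · exact partial_sum_stays_zero hf (Nat.zero_le v) hv (sum_range_zero _) fun v' _ h2 h3 => by
        have := hone v' (by omega) h3
        omega
  intro v hv
  have h1 := key v hv.le
  have h2 := key (v + 1) hv
  rw [sum_range_succ, h1] at h2
  split_ifs at h2 ⊢ <;> omega

namespace IsASM

variable {k : ℕ} {α β : ℕ → ℕ → ℤ}

lemma row_eq (hα : IsASM k α) {u g : ℕ} (hu : u < k) (h : ∀ v < k, α u v = 1 → v = g) :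
    ∀ v < k, α u v = if v = g then 1 else 0 :=
  eq_ite_of_one (hα.row u hu) (hα.row_total u hu) h

lemma col_eq (hα : IsASM k α) {v g : ℕ} (hv : v < k) (h : ∀ u < k, α u v = 1 → u = g) :
    ∀ u < k, α u v = if u = g then 1 else 0 :=
  eq_ite_of_one (f := fun u => α u v) (hα.col v hv) (hα.col_total v hv) h

/-- The column totals recover the missing row. -/
lemma eq_of_rows (hα : IsASM k α) (hβ : IsASM k β) (u₀ : ℕ)
    (h : ∀ u < k, u ≠ u₀ → ∀ v < k, α u v = β u v) : ∀ u < k, ∀ v < k, α u v = β u v := by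
  intro u hu v hv
  by_cases hu0 : u = u₀
  · subst hu0
    have h1 := hα.col_total v hv
    have h2 := hβ.col_total v hv
    rw [← add_sum_erase _ _ (mem_range.2 hu)] at h1 h2
    rw [sum_congr rfl fun u' hu' => h u' (mem_range.1 (mem_of_mem_erase hu'))
      (ne_of_mem_erase hu') v hv] at h1
    omega
  · exact h u hu hu0 v hv

end IsASM

namespace Grid

variable {n : ℕ} {G : ℕ → ℕ → Prop} {g h : ℕ → ℕ}

lemma isASM_perm (hG : Grid n G g h) : IsASM n (permMatrix g) :=
  isASM_permMatrix (fun u _ => hG.g_lt u) (fun v _ => hG.h_lt v) fun u hu v hv => by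
    rw [← hG.row u v hv, hG.col u v hu]

lemma eq_perm (hG : Grid n G g h) {β : ℕ → ℕ → ℤ} (hβ : IsASM n β)
    (h1 : ∀ u < n, ∀ v < n, β u v = 1 → G u v) : ∀ u < n, ∀ v < n, β u v = permMatrix g u v :=
  fun u hu => hβ.row_eq hu fun v hv hv1 => (hG.row u v hv).1 (h1 u hu v hv hv1)

/-- The alternating sign matrix of size `n + 1` supported on a grid that avoids the corners. -/
def extendedMatrix (n : ℕ) (g h : ℕ → ℕ) (u v : ℕ) : ℤ :=
  (if v = g u then 1 else 0) +
    if u = h 0 then (if v = n then 1 else 0) - (if v = g 0 then 1 else 0) else 0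

lemma g_eq_zero_iff (hG : Grid n G g h) (u : ℕ) (hu : u < n) : g u = 0 ↔ u = h 0 := by
  have hn := hG.g_lt 0
  rw [← hG.col u 0 hu, hG.row u 0 (by omega)]
  omega

lemma g_last (hG : Grid n G g h) : g n = g 0 := by
  have h1 := (hG.row 0 _ (hG.g_lt 0)).2 rfl
  rw [← hG.bottom, hG.row n _ (hG.g_lt 0)] at h1
  exact h1.symm

lemma h_last (hG : Grid n G g h) : h n = h 0 := by
  have h1 := (hG.col _ 0 (hG.h_lt 0)).2 rfl
  rw [← hG.right, hG.col _ n (hG.h_lt 0)] at h1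
  exact h1.symm

lemma g_zero_iff (hG : Grid n G g h) : g 0 = 0 ↔ h 0 = 0 := by
  have := hG.g_eq_zero_iff 0 (by have := hG.g_lt 0; omega)
  omega

/-- Transposition exchanges `g` and `h`, so the column conditions reduce to the row conditions of
the transposed grid. -/
lemma extendedMatrix_transpose (hG : Grid n G g h) (h0 : g 0 ≠ 0) {u v : ℕ} (hu : u ≤ n)
    (hv : v ≤ n) : extendedMatrix n g h u v = extendedMatrix n h g v u := by
  have hn := hG.g_lt 0
  have hn' := hG.h_lt 0
  have h0' : h 0 ≠ 0 := fun h => h0 (hG.g_zero_iff.2 h)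
  have hg := hG.g_last
  have hh := hG.h_last
  have e1 := hG.g_lt u
  have e2 := hG.h_lt v
  simp only [extendedMatrix]
  rcases hu.lt_or_eq with hu | rfl <;> rcases hv.lt_or_eq with hv | rfl
  · have e3 : v = g u ↔ u = h v := by rw [← hG.row u v hv, hG.col u v hu]
    split_ifs <;> omega
  · split_ifs <;> omega
  · split_ifs <;> omega
  · split_ifs <;> omega

lemma extendedMatrix_row (hG : Grid n G g h) (u v : ℕ) :
    (∑ v' ∈ range v, extendedMatrix n g h u v' = 0 ∨
      ∑ v' ∈ range v, extendedMatrix n g h u v' = 1) ∧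
      ∑ v' ∈ range (n + 1), extendedMatrix n g h u v' = 1 := by
  have hn := hG.g_lt 0
  have e1 := hG.g_lt u
  have e2 := hG.g_eq_zero_iff u
  have key : ∀ m, ∑ v' ∈ range m, extendedMatrix n g h u v' = (if g u < m then 1 else 0) +
      if u = h 0 then (if n < m then 1 else 0) - (if g 0 < m then 1 else 0) else 0 := by
    intro m
    simp only [extendedMatrix, sum_add_distrib, sum_range_ite_eq]
    congr 1
    by_cases hu0 : u = h 0
    · simp only [if_pos hu0, sum_sub_distrib, sum_range_ite_eq]
    · simp only [if_neg hu0, sum_const_zero]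
  have e3 := hG.h_lt 0
  rw [key, key]
  constructor <;> split_ifs <;> omega

lemma symm (hG : Grid n G g h) : Grid n (fun u v => G v u) h g where
  g_lt := hG.h_lt
  h_lt := hG.g_lt
  row u v hv := hG.col v u hv
  col u v hu := hG.row v u hu
  right := hG.bottom
  bottom := hG.right

lemma isASM_extendedMatrix (hG : Grid n G g h) (h0 : g 0 ≠ 0) :
    IsASM (n + 1) (extendedMatrix n g h) where
  row u _ v _ := (hG.extendedMatrix_row u v).1
  row_total u _ := (hG.extendedMatrix_row u 0).2
  col v hv u hu := by
    rw [sum_congr rfl fun u' hu' => hG.extendedMatrix_transpose h0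
      (by rw [mem_range] at hu'; omega) (by omega)]
    exact (hG.symm.extendedMatrix_row v u).1
  col_total v hv := by
    rw [sum_congr rfl fun u' hu' => hG.extendedMatrix_transpose h0
      (by rw [mem_range] at hu'; omega) (by omega)]
    exact (hG.symm.extendedMatrix_row v 0).2

/-- In a row other than `h 0` the grid allows one column only. Row `h 0` allows both columns `0` and
`n`, and is recovered from the column totals. -/
lemma eq_extendedMatrix (hG : Grid n G g h) (h0 : g 0 ≠ 0) {β : ℕ → ℕ → ℤ}
    (hβ : IsASM (n + 1) β) (h1 : ∀ u < n + 1, ∀ v < n + 1, β u v = 1 → G u v) :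
    ∀ u < n + 1, ∀ v < n + 1, β u v = extendedMatrix n g h u v := by
  refine hβ.eq_of_rows (hG.isASM_extendedMatrix h0) (h 0) fun u hu hu0 v hv => ?_
  rw [extendedMatrix, if_neg hu0, add_zero]
  refine hβ.row_eq hu (fun v hv hv1 => ?_) v hv
  have hGuv := h1 u hu v hv hv1
  rcases (Nat.lt_succ_iff.1 hv).lt_or_eq with hv | rfl
  · exact (hG.row u v hv).1 hGuv
  · rw [hG.right] at hGuv
    have hn := hG.g_lt 0
    rcases (Nat.lt_succ_iff.1 hu).lt_or_eq with hu | rfl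
    · exact absurd ((hG.col u 0 hu).1 hGuv) hu0
    · rw [hG.bottom, hG.row 0 0 (by omega)] at hGuv
      exact absurd hGuv.symm h0

/-- The permutation of `0, …, n` that sends `0` to `a`, `n` to `n - a`, and agrees with `g`
elsewhere. -/
def cornerPerm (n a : ℕ) (g : ℕ → ℕ) (u : ℕ) : ℕ :=
  if u = 0 then a else if u = n then n - a else g u

lemma interior (hG : Grid n G g h) (h0 : g 0 = 0) {u : ℕ} (hu : 0 < u) (hun : u < n) :
    0 < g u := by
  have := hG.g_eq_zero_iff u hun
  have := hG.g_zero_iff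
  omega

lemma isASM_cornerPerm (hG : Grid n G g h) (h0 : g 0 = 0) {a : ℕ} (ha : a = 0 ∨ a = n) :
    IsASM (n + 1) (permMatrix (cornerPerm n a g)) := by
  have h0' := hG.g_zero_iff.1 h0
  have hn := hG.g_lt 0
  refine isASM_permMatrix (h := cornerPerm n a h) ?_ ?_ ?_
  · intro u hu
    have := hG.g_lt u
    simp only [cornerPerm]
    split_ifs <;> omega
  · intro u hu
    have := hG.h_lt u
    simp only [cornerPerm]
    split_ifs <;> omega
  · intro u hu v hv
    have e1 := hG.g_lt u
    have e2 := hG.h_lt v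
    have e3 := hG.interior (u := u) h0
    have e4 := hG.symm.interior (u := v) h0'
    simp only [cornerPerm]
    by_cases hc : u < n ∧ v < n
    · have e5 : v = g u ↔ u = h v := by rw [← hG.row u v hc.2, hG.col u v hc.1]
      split_ifs <;> omega
    · split_ifs <;> omega

/-- Interior rows and columns allow one position each, so only the four corners are undetermined.
The first row has a single `1`, at column `0` or `n`, and the last row follows from the column
totals. -/
lemma eq_cornerPerm (hG : Grid n G g h) (h0 : g 0 = 0) {β : ℕ → ℕ → ℤ}
    (hβ : IsASM (n + 1) β) (h1 : ∀ u < n + 1, ∀ v < n + 1, β u v = 1 → G u v) :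
    ∃ a, (a = 0 ∨ a = n) ∧ ∀ u < n + 1, ∀ v < n + 1, β u v = permMatrix (cornerPerm n a g) u v := by
  have h0' := hG.g_zero_iff.1 h0
  have hn := hG.g_lt 0
  have hmid : ∀ u, 0 < u → u < n → ∀ v < n + 1, β u v = if v = g u then 1 else 0 := by
    intro u hu0 hun
    refine hβ.row_eq (by omega) fun v hv hv1 => ?_
    have hGuv := h1 u (by omega) v hv hv1
    rcases (Nat.lt_succ_iff.1 hv).lt_or_eq with hv | rfl
    · exact (hG.row u v hv).1 hGuv
    · rw [hG.right, hG.col u 0 hun] at hGuv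
      omega
  have hzero : ∀ v, 0 < v → v < n → β 0 v = 0 := by
    intro v hv0 hvn
    have hcol := hβ.col_eq (v := v) (g := h v) (by omega) (fun u hu hu1 => by
      have hGuv := h1 u hu v (by omega) hu1
      rcases (Nat.lt_succ_iff.1 hu).lt_or_eq with hu | rfl
      · exact (hG.col u v hu).1 hGuv
      · rw [hG.bottom, hG.row 0 v hvn] at hGuv
        omega) 0 (by omega)
    have := hG.symm.interior h0' hv0 hvn
    rw [hcol, if_neg (by omega)]
  have hfirst : ∃ a, (a = 0 ∨ a = n) ∧ ∀ v < n + 1, β 0 v = if v = a then 1 else 0 := by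
    have hT := hβ.row 0 (by omega)
    have hsum : ∑ v ∈ range n, β 0 v = β 0 0 :=
      sum_eq_single 0 (fun v hv hv0 => hzero v (by omega) (mem_range.1 hv))
        (fun h => absurd (mem_range.2 (by omega)) h)
    have htot := hβ.row_total 0 (by omega)
    rw [sum_range_succ, hsum] at htot
    rcases hT n (by omega) with h | h <;> rw [hsum] at h
    · refine ⟨n, Or.inr rfl, fun v hv => ?_⟩
      have := hzero v
      split_ifs with hvn
      · subst hvn; omega
      · rcases Nat.eq_zero_or_pos v with rfl | hv0
        · exact h
        · exact this hv0 (by omega)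
    · refine ⟨0, Or.inl rfl, fun v hv => ?_⟩
      have := hzero v
      split_ifs with hv0
      · subst hv0; omega
      · rcases (Nat.lt_succ_iff.1 hv).lt_or_eq with hvn | rfl
        · exact this (by omega) hvn
        · omega
  obtain ⟨a, ha, hrow⟩ := hfirst
  refine ⟨a, ha, hβ.eq_of_rows (hG.isASM_cornerPerm h0 ha) n fun u hu hun v hv => ?_⟩
  rcases Nat.eq_zero_or_pos u with rfl | hu0
  · rw [hrow v hv, permMatrix, cornerPerm, if_pos rfl]
  · rw [hmid u hu0 (by omega) v hv, permMatrix, cornerPerm, if_neg (show ¬u = 0 by omega), if_neg hun]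

end Grid

lemma dvd_sub_iff_eq_emod {n : ℕ} {v : ℕ} (hv : v < n) (w : ℤ) :
    (n : ℤ) ∣ v - w ↔ v = (w % n).toNat := by
  have hn : (0 : ℤ) < n := by omega
  have h1 := Int.emod_nonneg w hn.ne'
  constructor
  · intro h
    have h2 : (v : ℤ) % n = w % n := Int.emod_eq_emod_iff_emod_sub_eq_zero.2
      (Int.emod_eq_zero_of_dvd h)
    rw [← h2, Int.emod_eq_of_lt (by omega) (by omega)]
    simp
  · intro h
    have h2 : (v : ℤ) = w % n := by omega
    rw [h2]
    exact Int.dvd_of_emod_eq_zero (by simp [Int.sub_emod])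

/-- Both coefficients of `2u + v` are invertible modulo the odd number `n`, so each of `u`, `v`
determines the other modulo `n`. -/
lemma exists_grid {n : ℕ} (hn : Odd n) (c : ℤ) :
    ∃ g h : ℕ → ℕ, Grid n (fun u v => (n : ℤ) ∣ 2 * u + v - c) g h := by
  obtain ⟨t, ht⟩ := hn
  have hn0 : (0 : ℤ) < n := by omega
  have hlt : ∀ w : ℤ, (w % n).toNat < n := fun w => by
    have := Int.emod_nonneg w hn0.ne'
    have := Int.emod_lt_of_pos w hn0
    omega
  have hnt : (n : ℤ) = 2 * t + 1 := by omega
  -- With `n = 2t + 1`, the inverse of 2 modulo `n` is `t + 1`.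
  refine ⟨fun u => ((c - 2 * u) % n).toNat, fun v => (((t + 1) * (c - v)) % n).toNat,
    fun u => hlt _, fun v => hlt _, fun u v hv => ?_, fun u v hu => ?_, fun u => ?_, fun v => ?_⟩
  · rw [← dvd_sub_iff_eq_emod hv]
    ring_nf
  · rw [← dvd_sub_iff_eq_emod hu]
    constructor
    · rintro ⟨q, hq⟩
      refine ⟨(t + 1) * q - u, ?_⟩
      linear_combination ((t : ℤ) + 1) * hq + u * hnt
    · rintro ⟨q, hq⟩
      refine ⟨2 * q + (c - v), ?_⟩
      linear_combination 2 * hq - (c - v) * hnt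
  · rw [show (2 * u + n - c : ℤ) = (2 * u + (0 : ℕ) - c) + n by push_cast; ring,
      dvd_add_self_right]
  · rw [show (2 * n + v - c : ℤ) = (2 * (0 : ℕ) + v - c) + n * 2 by push_cast; ring,
      dvd_add_left (dvd_mul_right _ _)]

/-! ### Values at the special families -/

section Field

variable {K : Type*} [Field K]

/-- The families of variables at which the `F`-polynomials are evaluated. -/
structure Special (n : ℕ) (y : ℤ → K) : Prop where
  periodic : Function.Periodic y (2 * (n : ℤ))
  eq_neg_one : ∀ i ∈ arithProg 2 (2 * (n : ℤ) - 2) 2, y i = -1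
  prod_eq_one : ∏ i ∈ Icc (1 : ℤ) (2 * (n : ℤ)), y i = 1

lemma prod_Icc_two_mul (y : ℤ → K) (m : ℕ) : ∏ i ∈ Icc (1 : ℤ) (2 * (m : ℤ)), y i =
    (∏ i ∈ range m, y (1 + 2 * (i : ℤ))) * ∏ i ∈ range m, y (2 + 2 * (i : ℤ)) := by
  induction m with
  | zero => simp
  | succ m ih =>
    rw [show Icc (1 : ℤ) (2 * ((m + 1 : ℕ) : ℤ)) =
      insert (2 + 2 * (m : ℤ)) (insert (1 + 2 * (m : ℤ)) (Icc 1 (2 * (m : ℤ)))) by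
        ext x; simp only [mem_insert, mem_Icc]; push_cast; omega,
      prod_insert (by simp only [mem_insert, mem_Icc]; omega),
      prod_insert (by simp only [mem_Icc]; omega), ih, prod_range_succ, prod_range_succ]
    ring

lemma prod_range_ite {m a : ℕ} (ha : a < m) (x : K) :
    ∏ v ∈ range m, (if v = a then x else -1) = x * (-1) ^ (m - 1) := by
  rw [← mul_prod_erase _ _ (mem_range.2 ha), if_pos rfl,
    prod_congr rfl fun v hv => if_neg (ne_of_mem_erase hv), prod_const,
    card_erase_of_mem (mem_range.2 ha), card_range]

namespace Special

variable {n : ℕ} {y : ℤ → K}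

lemma two_mul (hy : Special n y) (hn : 0 < n) (t : ℤ) :
    ((n : ℤ) ∣ t → y (2 * t) = y 0) ∧ (¬ (n : ℤ) ∣ t → y (2 * t) = -1) := by
  have hmod : y (2 * t) = y (2 * (t % n)) := by
    have h := hy.periodic.int_mul (t / n) (2 * (t % n))
    rw [← h]
    congr 1
    have := Int.emod_add_mul_ediv t n
    push_cast
    linear_combination (-2) * this
  have h1 := Int.emod_nonneg t (b := n) (by omega)
  have h2 := Int.emod_lt_of_pos t (b := n) (by omega)
  constructor
  · intro h
    rw [hmod, Int.emod_eq_zero_of_dvd h, mul_zero]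
  · intro h
    have h3 : t % n ≠ 0 := fun h0 => h (Int.dvd_of_emod_eq_zero h0)
    rw [hmod]
    refine hy.eq_neg_one _ ⟨by omega, by omega, ?_⟩
    rw [Int.ModEq]
    omega

lemma ne_zero (hy : Special n y) (hn : 0 < n) (i : ℤ) : y i ≠ 0 := by
  have hN : (0 : ℤ) < 2 * n := by omega
  have h1 := Int.emod_nonneg (i - 1) hN.ne'
  have h2 := Int.emod_lt_of_pos (i - 1) hN
  have hmod : y i = y ((i - 1) % (2 * n) + 1) := by
    have h := hy.periodic.int_mul ((i - 1) / (2 * n)) ((i - 1) % (2 * n) + 1)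
    rw [← h]
    congr 1
    have := Int.emod_add_mul_ediv (i - 1) (2 * n)
    push_cast
    linear_combination (-1) * this
  rw [hmod]
  refine (prod_ne_zero_iff (f := y) (s := Icc (1 : ℤ) (2 * n))).1 ?_ _ ?_
  · rw [hy.prod_eq_one]
    exact one_ne_zero
  · rw [mem_Icc]
    omega

/-- The even-indexed variables of a period multiply to `y 0 * (-1) ^ (n - 1) = y 0`, so the
odd-indexed ones multiply to its inverse. Periodicity makes the starting point immaterial. -/
lemma prod_range_odd (hy : Special n y) (hn : Odd n) (t : ℤ) :
    (∏ v ∈ range n, y (1 + 2 * t + 2 * (v : ℤ))) * y 0 = 1 := by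
  have hn0 : 0 < n := hn.pos
  have hstep : ∀ a : ℤ,
      ∏ v ∈ range n, y (a + 2 + 2 * (v : ℤ)) = ∏ v ∈ range n, y (a + 2 * (v : ℤ)) := by
    intro a
    have h1 := prod_range_succ (fun v : ℕ => y (a + 2 * (v : ℤ))) n
    have h2 := prod_range_succ' (fun v : ℕ => y (a + 2 * (v : ℤ))) n
    rw [h1, hy.periodic a] at h2
    simp only [Nat.cast_zero, mul_zero, add_zero] at h2
    rw [mul_left_injective₀ (hy.ne_zero hn0 a) h2]
    refine prod_congr rfl fun v _ => ?_
    congr 1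
    push_cast
    ring
  have heven : ∏ v ∈ range n, y (2 + 2 * (v : ℤ)) = y 0 := by
    have h := hstep 0
    simp only [zero_add] at h
    rw [h, prod_congr rfl (g := fun v => if v = 0 then y 0 else -1), prod_range_ite hn0]
    · rw [(Nat.Odd.sub_odd hn odd_one).neg_one_pow, mul_one]
    · intro v hv
      rw [mem_range] at hv
      split_ifs with hv0
      · simp [hv0]
      · refine (hy.two_mul hn0 v).2 fun h => hv0 ?_
        exact Nat.eq_zero_of_dvd_of_lt (Int.natCast_dvd_natCast.1 h) hv
  have hodd : ∏ v ∈ range n, y (1 + 2 * t + 2 * (v : ℤ)) = ∏ v ∈ range n, y (1 + 2 * (v : ℤ)) := by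
    induction t using Int.induction_on with
    | zero => simp
    | succ t ih =>
      rw [← ih, ← hstep (1 + 2 * (t : ℤ))]
      simp only [mul_add, mul_one, add_assoc]
    | pred t ih =>
      rw [← ih, ← hstep]
      refine prod_congr rfl fun v _ => ?_
      congr 1
      ring
  rw [hodd]
  calc _ = (∏ v ∈ range n, y (1 + 2 * (v : ℤ))) * ∏ v ∈ range n, y (2 + 2 * (v : ℤ)) := by
        rw [heven]
    _ = 1 := by rw [← prod_Icc_two_mul, hy.prod_eq_one]

/-- Each of the `n` rows of sites runs through one full period of odd indices. -/
lemma prod_sites_odd (hy : Special n y) (hn : Odd n) {j : ℤ} (hj : Odd j) :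
    (∏ q ∈ sites n, y (idx j q)) * y 0 ^ n = 1 := by
  rw [prod_sites, show y 0 ^ n = ∏ _u ∈ range n, y 0 by simp, ← prod_mul_distrib]
  refine Finset.prod_eq_one fun u _ => ?_
  obtain ⟨i, rfl⟩ := hj
  obtain ⟨l, rfl⟩ := hn
  rw [← hy.prod_range_odd ⟨l, rfl⟩ (i + 2 * u - 3 * l)]
  congr 1
  refine prod_congr rfl fun v _ => ?_
  congr 1
  simp only [idx, cell]
  push_cast
  ring

end Special

lemma onesProd_permMatrix {y : ℤ → K} {j : ℤ} {k : ℕ} {g : ℕ → ℕ} (hg : ∀ u < k, g u < k)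
    {x : K} (hx : ∀ u < k, y (idx j (cell k u (g u))) = x) :
    onesProd y j k (permMatrix g) = (1 + x) ^ k := by
  rw [onesProd, ← card_range k, ← prod_const, card_range]
  refine prod_congr rfl fun u hu => ?_
  rw [mem_range] at hu
  rw [← hx u hu, prod_eq_single (g u)]
  · simp [permMatrix]
  · intro v _ hv
    simp [permMatrix, hv]
  · intro h
    exact absurd (mem_range.2 (hg u hu)) h

/-- Every one of the `n + 1` rows has an entry `1`, and row `h 0` has a second one in column `n`. -/
lemma Grid.onesProd_extendedMatrix {n : ℕ} {G : ℕ → ℕ → Prop} {g h : ℕ → ℕ} (hG : Grid n G g h)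
    (h0 : g 0 ≠ 0) {y : ℤ → K} {j : ℤ} {x : K}
    (hx : ∀ u v, G u v → y (idx j (cell (n + 1) u v)) = x) :
    onesProd y j (n + 1) (extendedMatrix n g h) = (1 + x) ^ (n + 2) := by
  have hn := hG.g_lt 0
  have hrow : ∀ u ∈ range (n + 1), ∏ v ∈ range (n + 1),
      (if extendedMatrix n g h u v = 1 then 1 + y (idx j (cell (n + 1) u v)) else 1) =
      (1 + x) * if u = h 0 then 1 + x else 1 := by
    intro u hu
    rw [mem_range] at hu
    have e1 := hG.g_lt u
    have e2 := hG.g_eq_zero_iff u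
    have e3 := hG.h_lt 0
    rw [prod_range_succ]
    congr 1
    · rw [prod_eq_single (g u)]
      · rw [if_pos, hx u _ ((hG.row u _ e1).2 rfl)]
        rw [extendedMatrix]
        split_ifs <;> omega
      · intro v hv hvg
        rw [mem_range] at hv
        rw [if_neg]
        rw [extendedMatrix]
        split_ifs <;> omega
      · intro h
        exact absurd (mem_range.2 e1) h
    · split_ifs with h1 h2 h2
      · rw [hx]
        rw [hG.right, hG.col u 0 (by omega)]
        exact h2
      · rw [extendedMatrix] at h1
        split_ifs at h1 <;> omega
      · exfalso
        rw [extendedMatrix] at h1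
        split_ifs at h1 <;> omega
      · rfl
  rw [onesProd, prod_congr rfl hrow, prod_mul_distrib, prod_const, card_range, prod_ite_eq',
    if_pos (mem_range.2 (by have := hG.h_lt 0; omega)), ← pow_succ]

end Field

/-! ### Comparing the two permutation matrices when the corners lie on the grid -/

namespace Grid

variable {n : ℕ} {G : ℕ → ℕ → Prop} {g h : ℕ → ℕ}

/-- Every interior corner sum includes the top-left entry and none of the other three corner
entries, so only that entry makes a difference. -/
lemma corner_cornerPerm (hG : Grid n G g h) (h0 : g 0 = 0) {u v : ℕ} (hu : u < n) (hv : v < n) :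
    (Height.ofMatrix (n + 1) (permMatrix (cornerPerm n 0 g))).corner (n + 1) (u + 1) (v + 1) =
    (Height.ofMatrix (n + 1) (permMatrix (cornerPerm n n g))).corner (n + 1) (u + 1) (v + 1) + 1 := by
  rw [Height.corner_ofMatrix (hG.isASM_cornerPerm h0 (Or.inl rfl)) (by omega) (by omega),
    Height.corner_ofMatrix (hG.isASM_cornerPerm h0 (Or.inr rfl)) (by omega) (by omega)]
  simp only [permMatrix, sum_range_ite_eq]
  rw [sum_range_succ', sum_range_succ' (n := u)]
  have : ∀ u' ∈ range u, (if cornerPerm n 0 g (u' + 1) < v + 1 then (1 : ℤ) else 0) =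
      if cornerPerm n n g (u' + 1) < v + 1 then 1 else 0 := by
    intro u' hu'
    rw [mem_range] at hu'
    simp only [cornerPerm, Nat.succ_ne_zero, if_false, if_neg (show ¬u' + 1 = n by omega)]
  rw [sum_congr rfl this]
  simp only [cornerPerm, if_true]
  rw [if_pos (by omega), if_neg (by omega)]
  ring

lemma ofMatrix_cornerPerm (hG : Grid n G g h) (h0 : g 0 = 0) {q : ℤ × ℤ} (hq : q ∈ sites n) :
    Height.ofMatrix (n + 1) (permMatrix (cornerPerm n n g)) q =
      Height.ofMatrix (n + 1) (permMatrix (cornerPerm n 0 g)) q + 1 := by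
  obtain ⟨u, hu, v, hv, rfl⟩ := exists_cell hq
  have := hG.corner_cornerPerm h0 hu hv
  rw [Height.corner, Height.corner, ← cell_sub_one (by omega), Nat.add_sub_cancel] at this
  omega

/-- All interior heights rise by 1. At the two excluded corners both the `e`- and the `w`-neighbour
lie on the boundary, where heights stay zero; every other cell has an interior one, and
nonnegativity makes the maximum rise. -/
lemma max_cornerPerm (hG : Grid n G g h) (h0 : g 0 = 0) {u v : ℕ} (hu : u < n + 1)
    (hv : v < n + 1) :
    max (Height.e (Height.ofMatrix (n + 1) (permMatrix (cornerPerm n n g))) (cell (n + 1) u v))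
      (Height.w (Height.ofMatrix (n + 1) (permMatrix (cornerPerm n n g))) (cell (n + 1) u v)) =
    max (Height.e (Height.ofMatrix (n + 1) (permMatrix (cornerPerm n 0 g))) (cell (n + 1) u v))
      (Height.w (Height.ofMatrix (n + 1) (permMatrix (cornerPerm n 0 g))) (cell (n + 1) u v)) +
      if (u = 0 ∧ v = n) ∨ (u = n ∧ v = 0) then 0 else 1 := by
  have hn : 0 < n := by have := hG.g_lt 0; omega
  set b := Height.ofMatrix (n + 1) (permMatrix (cornerPerm n 0 g)) with hb
  set b' := Height.ofMatrix (n + 1) (permMatrix (cornerPerm n n g)) with hb'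
  have hpos := Height.nonneg_of_mem_finsupp
    (Height.ofMatrix_mem (hG.isASM_cornerPerm h0 (a := 0) (Or.inl rfl)))
  have key : ∀ u v : ℕ, 0 ≤ b (vertex (n + 1) u v) ∧
      (((0 < u ∧ u < n + 1) ∧ 0 < v ∧ v < n + 1) →
        b' (vertex (n + 1) u v) = b (vertex (n + 1) u v) + 1) ∧
      (¬((0 < u ∧ u < n + 1) ∧ 0 < v ∧ v < n + 1) →
        b' (vertex (n + 1) u v) = 0 ∧ b (vertex (n + 1) u v) = 0) := by
    intro u v
    refine ⟨hpos _, fun h => hG.ofMatrix_cornerPerm h0 ?_, fun h => ?_⟩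
    · have := (vertex_mem_sites (k := n + 1)).2 h
      rwa [Nat.add_sub_cancel] at this
    · rw [← vertex_mem_sites] at h
      exact ⟨Height.eq_zero_of_notMem (Height.support_ofMatrix _ _) h,
        Height.eq_zero_of_notMem (Height.support_ofMatrix _ _) h⟩
  have hE : ((cell (n + 1) u v).1 + 1, (cell (n + 1) u v).2 + 1) =
      vertex (n + 1) (u + 1) (v + 1) := by
    ext <;> simp only [cell, vertex] <;> push_cast <;> ring
  have hW : ((cell (n + 1) u v).1 + -1, (cell (n + 1) u v).2 + -1) = vertex (n + 1) u v := by
    ext <;> simp only [cell, vertex] <;> ring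
  have k1 := key u v
  have k2 := key (u + 1) (v + 1)
  simp only [Height.e, Height.w, hE, hW]
  split_ifs <;> omega

lemma mem_cornerPerm (hG : Grid n G g h) (h0 : g 0 = 0) {a : ℕ} (ha : a = 0 ∨ a = n) {u : ℕ}
    (hu : u < n + 1) : G u (cornerPerm n a g u) := by
  have h00 := (hG.row 0 0 (by have := hG.g_lt 0; omega)).2 h0.symm
  rw [cornerPerm]
  split_ifs with hu0 hun
  · subst hu0
    rcases ha with rfl | rfl
    · exact h00
    · exact (hG.right 0).2 h00
  · subst hun
    rcases ha with rfl | rfl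
    · exact (hG.right _).2 ((hG.bottom 0).2 h00)
    · rw [Nat.sub_self]
      exact (hG.bottom 0).2 h00
  · exact (hG.row u _ (hG.g_lt u)).2 rfl

variable {K : Type*} [Field K]

lemma weight_cornerPerm (hG : Grid n G g h) (h0 : g 0 = 0) {y : ℤ → K} (hy : ∀ i, y i ≠ 0)
    (j : ℤ) : weight y j (n + 1) (Height.ofMatrix (n + 1) (permMatrix (cornerPerm n n g))) =
      weight y j (n + 1) (Height.ofMatrix (n + 1) (permMatrix (cornerPerm n 0 g))) *
        ((∏ q ∈ sites n, y (idx j q)) * ∏ u ∈ range (n + 1), ∏ v ∈ range (n + 1),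
          if (u = 0 ∧ v = n) ∨ (u = n ∧ v = 0) then 1 else y (idx j (cell (n + 1) u v))) := by
  rw [weight, weight, mul_mul_mul_comm, Nat.add_sub_cancel, prod_sites _ (n + 1), prod_sites _ (n + 1)]
  congr 1
  · rw [← prod_mul_distrib]
    refine prod_congr rfl fun q hq => ?_
    rw [hG.ofMatrix_cornerPerm h0 hq, zpow_add₀ (hy _), zpow_one]
  · rw [← prod_mul_distrib]
    refine prod_congr rfl fun u hu => ?_
    rw [← prod_mul_distrib]
    refine prod_congr rfl fun v hv => ?_
    rw [hG.max_cornerPerm h0 (mem_range.1 hu) (mem_range.1 hv), zpow_add₀ (hy _)]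
    split_ifs <;> simp

/-- The product of the values `x` on a grid and `-1` elsewhere, without two opposite corners. -/
lemma prod_off_corners (hG : Grid n G g h) (h0 : g 0 = 0) (hn : Odd n) {f : ℕ → ℕ → K} {x : K}
    (hx : ∀ u v, G u v → f u v = x) (hx' : ∀ u v, ¬G u v → f u v = -1) :
    ∏ u ∈ range (n + 1), ∏ v ∈ range (n + 1),
      (if (u = 0 ∧ v = n) ∨ (u = n ∧ v = 0) then 1 else f u v) = x ^ (n + 1) := by
  have hn0 : 0 < n := hn.pos
  have hneg : (-1 : K) ^ (n - 1) = 1 := (Nat.Odd.sub_odd hn odd_one).neg_one_pow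
  have hnegn : (-1 : K) ^ n = -1 := hn.neg_one_pow
  have h0' := hG.g_zero_iff.1 h0
  have hval : ∀ u v, v < n → f u v = if v = g u then x else -1 := by
    intro u v hv
    split_ifs with h1
    · exact hx u v ((hG.row u v hv).2 h1)
    · exact hx' u v fun h2 => h1 ((hG.row u v hv).1 h2)
  have hlast : ∀ u, f u n = if u = 0 ∨ u = n then x else if u < n then -1 else f u n := by
    intro u
    split_ifs with h1 h2
    · refine hx u n ((hG.right u).2 ?_)
      rcases h1 with rfl | rfl
      · exact (hG.row 0 0 hn0).2 h0.symm
      · exact (hG.bottom 0).2 ((hG.row 0 0 hn0).2 h0.symm)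
    · refine hx' u n fun h3 => ?_
      rw [hG.right, hG.col u 0 h2] at h3
      omega
    · rfl
  -- A middle row has one factor `x` and `n` factors `-1`, which gives `-x` since `n` is odd; there
  -- are `n - 1` such rows, an even number, so the signs cancel.
  have hrow : ∀ u ∈ range (n + 1), ∏ v ∈ range (n + 1),
      (if (u = 0 ∧ v = n) ∨ (u = n ∧ v = 0) then 1 else f u v) =
      if u = 0 ∨ u = n then x else -x := by
    intro u hu
    rw [mem_range] at hu
    rw [prod_range_succ]
    by_cases hu0 : u = 0
    · subst hu0
      rw [prod_congr rfl (g := fun v => if v = 0 then x else -1), prod_range_ite hn0, hneg]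
      · simp
      · intro v hv
        rw [mem_range] at hv
        rw [if_neg (by omega), hval 0 v hv, h0]
    · by_cases hun : u = n
      · subst hun
        rw [prod_congr rfl (g := fun v => if v = 0 then 1 else -1), prod_range_ite hn0, hneg,
          if_neg (by omega), hlast]
        · simp
        · intro v hv
          rw [mem_range] at hv
          have hgl := hG.g_last
          by_cases hv0 : v = 0
          · rw [if_pos (by omega), if_pos hv0]
          · rw [if_neg (by omega), if_neg hv0, hval _ v hv, if_neg (by omega)]
      · rw [prod_congr rfl (g := fun v => if v = g u then x else -1), prod_range_ite (hG.g_lt u),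
          hneg, if_neg (by omega), if_neg (by omega), hlast, if_neg (by omega), if_pos (by omega)]
        · ring
        · intro v hv
          rw [mem_range] at hv
          rw [if_neg (by omega), hval u v hv]
  rw [prod_congr rfl hrow, prod_range_succ, if_pos (Or.inr rfl)]
  obtain ⟨m, rfl⟩ : ∃ m, n = m + 1 := ⟨n - 1, by omega⟩
  rw [prod_range_succ', if_pos (Or.inl rfl), prod_congr rfl (g := fun _ => -x), prod_const,
    card_range]
  · rw [Nat.add_sub_cancel] at hneg
    rw [neg_pow, hneg]
    ring
  · intro u hu
    rw [mem_range] at hu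
    rw [if_neg (by omega)]

end Grid

/-! ### Evaluation of the partition function -/

/-- The matrix coordinates of the sites whose variables specialize to `y 0`. -/
lemma Special.value {K : Type*} [Field K] {n : ℕ} {y : ℤ → K} (hy : Special n y) (hn : 0 < n)
    {j c : ℤ} {k : ℕ} (hc : 2 * c = 3 * ((k : ℤ) - 1) - j) (u v : ℕ) :
    ((n : ℤ) ∣ 2 * u + v - c → y (idx j (cell k u v)) = y 0) ∧
      (¬(n : ℤ) ∣ 2 * u + v - c → y (idx j (cell k u v)) = -1) := by
  have : idx j (cell k u v) = 2 * (2 * u + v - c) := by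
    simp only [idx, cell]
    linarith
  rw [this]
  exact hy.two_mul hn _

lemma partitionSum_special_self {n : ℕ} (hn : Odd n) {j : ℤ} (hj : Odd (j + n)) :
    ∃ m : ℤ → ℕ, ∀ (K : Type*) [Field K] (y : ℤ → K), Special n y →
      partitionSum y j n n = (∏ i ∈ Icc (1 : ℤ) (2 * (n : ℤ)), y i ^ m i) * (1 + y 0) ^ n := by
  have hn0 : 0 < n := hn.pos
  obtain ⟨c, hc⟩ : ∃ c : ℤ, 2 * c = 3 * ((n : ℤ) - 1) - j := by
    obtain ⟨a, ha⟩ := hj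
    obtain ⟨t, rfl⟩ := hn
    exact ⟨4 * t - a, by push_cast at ha ⊢; linarith⟩
  obtain ⟨g, h, hG⟩ := exists_grid hn c
  obtain ⟨m, hm⟩ := exists_exponents_weight j hG.isASM_perm (N := 2 * (n : ℤ)) (by omega)
  refine ⟨m, fun K _ y hy => ?_⟩
  have hval := hy.value hn0 hc
  rw [partitionSum_eq_sum (hy.ne_zero hn0) j n {permMatrix g}, sum_singleton,
    onesProd_permMatrix (fun u _ => hG.g_lt u) (x := y 0), hm K y hy.periodic]
  · intro u _
    exact (hval u _).1 ((hG.row u _ (hG.g_lt u)).2 rfl)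
  · intro α hα
    rw [mem_singleton.1 hα]
    exact hG.isASM_perm
  · intro α hα β hβ _
    rw [mem_singleton.1 hα, mem_singleton.1 hβ]
  · intro β hβ h1
    refine ⟨_, mem_singleton_self _, hG.eq_perm hβ fun u hu v hv huv => ?_⟩
    by_contra hcon
    exact h1 u hu v hv huv (by rw [(hval u v).2 hcon, add_neg_cancel])

lemma partitionSum_special_succ {n : ℕ} (hn : Odd n) {j : ℤ} (hj : Odd (j + (n + 1 : ℕ))) :
    ∃ m : ℤ → ℕ, ∀ (K : Type*) [Field K] (y : ℤ → K), Special n y →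
      partitionSum y j (n + 1) (n + 1) =
        (∏ i ∈ Icc (1 : ℤ) (2 * (n : ℤ)), y i ^ m i) * (1 + y 0) ^ (n + 2) := by
  have hn0 : 0 < n := hn.pos
  have hjo : Odd j := by
    obtain ⟨a, ha⟩ := hj
    obtain ⟨t, rfl⟩ := hn
    exact ⟨a - t - 1, by push_cast at ha; linarith⟩
  obtain ⟨c, hc⟩ : ∃ c : ℤ, 2 * c = 3 * (((n + 1 : ℕ) : ℤ) - 1) - j := by
    obtain ⟨a, rfl⟩ := hjo
    obtain ⟨t, rfl⟩ := hn
    exact ⟨3 * t + 1 - a, by push_cast; ring⟩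
  obtain ⟨g, h, hG⟩ := exists_grid hn c
  by_cases h0 : g 0 = 0
  · have hA := hG.isASM_cornerPerm h0 (a := 0) (Or.inl rfl)
    have hB := hG.isASM_cornerPerm h0 (a := n) (Or.inr rfl)
    obtain ⟨m, hm⟩ := exists_exponents_weight j hA (N := 2 * (n : ℤ)) (by omega)
    refine ⟨m, fun K _ y hy => ?_⟩
    have hval := hy.value hn0 hc
    have hne : ¬∀ u < n + 1, ∀ v < n + 1,
        permMatrix (Grid.cornerPerm n 0 g) u v = permMatrix (Grid.cornerPerm n n g) u v := by
      intro h
      have := h 0 (by omega) 0 (by omega)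
      simp only [permMatrix, Grid.cornerPerm, if_true] at this
      split_ifs at this <;> omega
    have hones : ∀ a, (a = 0 ∨ a = n) →
        onesProd y j (n + 1) (permMatrix (Grid.cornerPerm n a g)) = (1 + y 0) ^ (n + 1) := by
      intro a ha
      refine onesProd_permMatrix (fun u hu => ?_) fun u hu => (hval u _).1 ?_
      · have := hG.g_lt u
        simp only [Grid.cornerPerm]
        split_ifs <;> omega
      · exact hG.mem_cornerPerm h0 ha hu
    -- The odd-indexed sites contribute `y 0 ^ (-n)` and the even-indexed ones `y 0 ^ (n + 1)`. The
    -- sum of the two monomials is then the first one times `1 + y 0`.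
    have hratio : (∏ q ∈ sites n, y (idx j q)) * (∏ u ∈ range (n + 1), ∏ v ∈ range (n + 1),
        if (u = 0 ∧ v = n) ∨ (u = n ∧ v = 0) then 1 else y (idx j (cell (n + 1) u v))) = y 0 := by
      rw [hG.prod_off_corners h0 hn (fun u v => (hval u v).1) (fun u v => (hval u v).2), pow_succ,
        ← mul_assoc, hy.prod_sites_odd hn hjo, one_mul]
    classical
    rw [partitionSum_eq_sum (hy.ne_zero hn0) j (n + 1)
      {permMatrix (Grid.cornerPerm n 0 g), permMatrix (Grid.cornerPerm n n g)},
      sum_pair (fun h => hne fun u _ v _ => by rw [h]), hones 0 (Or.inl rfl), hones n (Or.inr rfl),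
      hG.weight_cornerPerm h0 (hy.ne_zero hn0), hratio, hm K y hy.periodic]
    · ring
    · intro α hα
      rcases mem_insert.1 hα with rfl | hα
      · exact hA
      · rw [mem_singleton.1 hα]
        exact hB
    · intro α hα β hβ hαβ
      rw [mem_insert, mem_singleton] at hα hβ
      rcases hα with rfl | rfl <;> rcases hβ with rfl | rfl
      · rfl
      · exact absurd hαβ hne
      · exact absurd (fun u hu v hv => (hαβ u hu v hv).symm) hne
      · rfl
    · intro β hβ h1
      obtain ⟨a, ha, hβa⟩ := hG.eq_cornerPerm h0 hβ fun u hu v hv huv => by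
        by_contra hcon
        exact h1 u hu v hv huv (by rw [(hval u v).2 hcon, add_neg_cancel])
      refine ⟨_, ?_, hβa⟩
      rcases ha with rfl | rfl <;> simp
  · obtain ⟨m, hm⟩ := exists_exponents_weight j (hG.isASM_extendedMatrix h0) (N := 2 * (n : ℤ))
      (by omega)
    refine ⟨m, fun K _ y hy => ?_⟩
    have hval := hy.value hn0 hc
    rw [partitionSum_eq_sum (hy.ne_zero hn0) j (n + 1) {Grid.extendedMatrix n g h}, sum_singleton,
      hG.onesProd_extendedMatrix h0 fun u v => (hval u v).1, hm K y hy.periodic]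
    · intro α hα
      rw [mem_singleton.1 hα]
      exact hG.isASM_extendedMatrix h0
    · intro α hα β hβ _
      rw [mem_singleton.1 hα, mem_singleton.1 hβ]
    · intro β hβ h1
      refine ⟨_, mem_singleton_self _, hG.eq_extendedMatrix h0 hβ fun u hu v hv huv => ?_⟩
      by_contra hcon
      exact h1 u hu v hv huv (by rw [(hval u v).2 hcon, add_neg_cancel])

end Pentagram

theorem mainTheorem5 (n : ℕ) (hn : Odd n) (j : ℤ) (k : ℕ) (hk : k = n ∨ k = n + 1)
    (hjk : Odd (j + (k : ℤ))) :
    ∃ P : MvPolynomial ℤ ℤ,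
      algebraMap Pentagram.YPoly Pentagram.YRat P = Pentagram.F j k ∧
      ∃ m : ℤ → ℕ, ∀ (K : Type*) [Field K] (y : ℤ → K),
        (∀ i : ℤ, y (i + 2 * (n : ℤ)) = y i) →
        (∀ i ∈ Pentagram.arithProg 2 (2 * (n : ℤ) - 2) 2, y i = -1) →
        ∏ i ∈ Finset.Icc (1 : ℤ) (2 * (n : ℤ)), y i = 1 →
          (k = n → MvPolynomial.aeval y P =
            (∏ i ∈ Finset.Icc (1 : ℤ) (2 * (n : ℤ)), y i ^ m i) * (1 + y 0) ^ n) ∧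
          (k = n + 1 → MvPolynomial.aeval y P =
            (∏ i ∈ Finset.Icc (1 : ℤ) (2 * (n : ℤ)), y i ^ m i) * (1 + y 0) ^ (n + 2)) ∧
          (y 0 ≠ -1 → (∀ i : ℤ, y i ≠ 0) → MvPolynomial.aeval y P ≠ 0) := by
  refine ⟨Pentagram.FPoly j k, Pentagram.algebraMap_FPoly k j, ?_⟩
  have hne : ∀ {K : Type _} [Field K] {y : ℤ → K} (m : ℤ → ℕ) (r : ℕ), y 0 ≠ -1 →
      (∀ i, y i ≠ 0) →
      (∏ i ∈ Finset.Icc (1 : ℤ) (2 * (n : ℤ)), y i ^ m i) * (1 + y 0) ^ r ≠ 0 := by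
    intro K _ y m r h0 hy
    refine mul_ne_zero (Finset.prod_ne_zero_iff.2 fun i _ => pow_ne_zero _ (hy i))
      (pow_ne_zero _ fun h => h0 ?_)
    rwa [add_comm, add_eq_zero_iff_eq_neg] at h
  rcases hk with rfl | rfl
  · obtain ⟨m, hm⟩ := Pentagram.partitionSum_special_self hn hjk
    refine ⟨m, fun K _ y h1 h2 h3 => ?_⟩
    rw [Pentagram.aeval_FPoly, hm K y ⟨h1, h2, h3⟩]
    exact ⟨fun _ => rfl, fun h => absurd h (by omega), hne m k⟩
  · obtain ⟨m, hm⟩ := Pentagram.partitionSum_special_succ hn hjk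
    refine ⟨m, fun K _ y h1 h2 h3 => ?_⟩
    rw [Pentagram.aeval_FPoly, hm K y ⟨h1, h2, h3⟩]
    exact ⟨fun h => absurd h (by omega), fun _ => rfl, hne m (n + 2)⟩
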